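/- Let $M$ be a smooth $n$-dimensional manifold, $\pi:T^*M\to M$ its cotangent bundle, $\vartheta=p_i\,dx^i$ the tautological form and $\omega=-d\vartheta$ the canonical symplectic form. A hybrid dynamical system $(N,S,X,\Delta)$ consists of a smooth manifold $N$, a smooth embedded hypersurface $S\subset N$ (the guard), a smooth vector field $X$ on $N$ and a smooth map $\Delta:S\to N$ (the reset) such that $\Delta(S)$ is a smooth embedded submanifold, $S\cap\Delta(S)=\emptyset$, and $\overline S\cap\overline{\Delta(S)}$ has codimension at least $2$. Its trajectories follow $\dot z=X(z)$, and are reset by $z^+=\Delta(z^-)$ each time they reach $S$; at a reset time the value of the trajectory is the state $z^-\in S$ before the reset. For $T\ge 0$ let $\varphi_T^{\mathcal H}$ denote the time-$T$ map of the hybrid flow. A point has a Zeno trajectory if there are infinitely many reset times $0\le t_0<t_1<\cdots$ on its trajectory with $t_i\to t_\infty<\infty$; the trajectory is spasmodic if the sequence of the states at its successive reset times escapes every compact set, and steady otherwise. Let $\mathcal H=(T^*M,S^*,X_H,\tilde\Delta)$ be a hybrid Hamiltonian system, that is, a hybrid dynamical system on $T^*M$ obtained as follows: $S\subset M$ and $\Delta:S\to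 M$ satisfy the conditions above on a guard and a reset in $M$, where $S=h^{-1}(0)$ for a smooth function $h$ on an open subset of $M$ with $dh\neq 0$ on $S$; $H:T^*M\to\mathbb R$ is smooth; $X_H$ is its Hamiltonian vector field, $i_{X_H}\omega=dH$; $S^*=\{z\in T^*M:\pi(z)\in S,\ (\pi^*dh)(X_H)(z)>0\}$; and $\tilde\Delta:S^*\to T^*M$ is smooth with $\pi\circ\tilde\Delta=\Delta\circ\pi$ and $(\mathrm{Id}\times\tilde\Delta)^*\vartheta_H=\iota^*\vartheta_H$, where $\vartheta_H=p_i\,dx^i-H\,dt$ on $\mathbb R\times T^*M$ and $\iota:\mathbb R\times S^*\hookrightarrow\mathbb R\times T^*M$ is the inclusion. Suppose that $\mathcal H$ has no spasmodic Zeno trajectories. Let $\mathcal N\subset T^*M$ be the set of the points that have a steady Zeno trajectory, let $x\in M$ be such that $T_x^*M\cap\mathcal N$ is a Lebesgue null set in the vector space $T_x^*M$, and put $V_x=T_x^*M\setminus\mathcal N$. Let $T\ge 0$ and let $\mathcal L\subset T^*M$ be an embedded Lagrangian submanifold with $$\varphi_T^{\mathcal H}(V_x)\cap\mathcal L=\emptyset,\qquad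 \overline{\varphi_T^{\mathcal H}(V_x)}\cap\mathcal L\neq\emptyset .$$ Then there are embedded Lagrangian submanifolds $\tilde{\mathcal L}$ arbitrarily close to $\mathcal L$ with $$\varphi_T^{\mathcal H}(V_x)\cap\tilde{\mathcal L}\neq\emptyset .$$ Here "arbitrarily close" means: for each neighbourhood $\mathcal U$ of the inclusion $\mathcal L\hookrightarrow T^*M$ in the strong (Whitney) $C^\infty$ topology on $C^\infty(\mathcal L,T^*M)$ one can take $\tilde{\mathcal L}=j(\mathcal L)$ for a smooth embedding $j\in\mathcal U$. -/

import Mathlib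

open scoped Manifold ContDiff Topology
open Set Filter

noncomputable section

/-! ### Submanifolds, hybrid dynamical systems and their trajectories -/

section Hybrid

variable {E : Type*} [NormedAddCommGroup E] [NormedSpace ℝ E]
  {H : Type*} [TopologicalSpace H] (I : ModelWithCorners ℝ E H)
  {N : Type*} [TopologicalSpace N] [ChartedSpace H N]

/-- Near its point `a` the set `A` is a slice of codimension `c`: some smooth chart around `a`
identifies `A` with a linear subspace of codimension `c`. -/
def IsSliceAt (A : Set N) (a : N) (c : ℕ) : Prop :=
  ∃ φ ∈ IsManifold.maximalAtlas I ∞ N, a ∈ φ.source ∧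
    ∃ W : Submodule ℝ E, Module.finrank ℝ W + c = Module.finrank ℝ E ∧
      ∀ y ∈ φ.source, y ∈ A ↔ φ.extend I y ∈ W

/-- `A` is a smooth embedded submanifold (of any dimension). -/
def IsEmbeddedSubmanifold (A : Set N) : Prop :=
  ∀ a ∈ A, ∃ c, IsSliceAt I A a c

/-- `A` is a smooth embedded submanifold of codimension one. -/
def IsEmbeddedHypersurface (A : Set N) : Prop :=
  ∀ a ∈ A, IsSliceAt I A a 1

/-- `A`, which need not be a submanifold, has codimension at least two: it is empty, or in all
charts its Hausdorff dimension is at most `dim N - 2`. -/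
def HasCodimAtLeastTwo (A : Set N) : Prop :=
  A = ∅ ∨ ∀ z : N,
    dimH (extChartAt I z '' (A ∩ (extChartAt I z).source)) + 2 ≤ (Module.finrank ℝ E : ENNReal)

/-- The conditions on a guard `S` and a reset `Δ : S → N` of a hybrid dynamical system. The reset
is given as a function on `N` of which only the restriction to `S` matters. -/
structure IsGuardReset (S : Set N) (Δ : N → N) : Prop where
  guard : IsEmbeddedHypersurface I S
  smooth : ContMDiffOn I I ∞ Δ S
  image : IsEmbeddedSubmanifold I (Δ '' S)
  disjoint : Disjoint S (Δ '' S)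
  codim : HasCodimAtLeastTwo I (closure S ∩ closure (Δ '' S))

variable (N) in
/-- A hybrid dynamical system `(N, S, X, Δ)` on the smooth manifold `N`. -/
structure HybridDynamicalSystem [IsManifold I 1 N] where
  /-- the guard `S` -/
  guard : Set N
  /-- the vector field `X` -/
  field : (z : N) → TangentSpace I z
  /-- the reset `Δ`; its values outside the guard are irrelevant -/
  reset : N → N
  smooth_field : ContMDiff I I.tangent ∞ (fun z => (⟨z, field z⟩ : TangentBundle I N))
  isGuardReset : IsGuardReset I guard reset

namespace HybridDynamicalSystem

variable {I} [IsManifold I 1 N] (𝓗 : HybridDynamicalSystem I N)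

/-- `γ` is a trajectory of `𝓗` on `[0, τ)`. Up to and including a time `t` it follows the vector
field, so that at a reset time `γ t ∈ S` is the state before the reset. After `t` it follows the
vector field from `Δ (γ t)` if `γ t` lies in the guard and from `γ t` otherwise. -/
structure IsTrajectory (γ : ℝ → N) (τ : ℝ) : Prop where
  left : ∀ t ∈ Ioo 0 τ, ∃ δ > 0, IsMIntegralCurveOn γ 𝓗.field (Ioc (t - δ) t)
  right : ∀ t ∈ Ico 0 τ, ∃ δ > 0, ∃ η : ℝ → N,
    IsMIntegralCurveOn η 𝓗.field (Ico t (t + δ)) ∧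
    (γ t ∈ 𝓗.guard → η t = 𝓗.reset (γ t)) ∧ (γ t ∉ 𝓗.guard → η t = γ t) ∧
    ∀ s ∈ Ioo t (t + δ), γ s = η s

/-- The image `φ_T(V)` of the set `V` under the time-`T` map of the hybrid flow: the states at
time `T` of the trajectories that start in `V`. -/
def flowImage (T : ℝ) (V : Set N) : Set N :=
  {w | ∃ (γ : ℝ → N) (τ : ℝ), T < τ ∧ 𝓗.IsTrajectory γ τ ∧ γ 0 ∈ V ∧ γ T = w}

/-- `t` is an increasing sequence of reset times of the trajectory `γ` from `z`, with finite
limit `τ`. -/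
structure IsZenoExecution (z : N) (γ : ℝ → N) (t : ℕ → ℝ) (τ : ℝ) : Prop where
  trajectory : 𝓗.IsTrajectory γ τ
  start : γ 0 = z
  strictMono : StrictMono t
  nonneg : ∀ i, 0 ≤ t i
  mem_guard : ∀ i, γ (t i) ∈ 𝓗.guard
  tendsto : Tendsto t atTop (𝓝 τ)

/-- The point `z` has a Zeno trajectory. -/
def IsZeno (z : N) : Prop := ∃ γ t τ, 𝓗.IsZenoExecution z γ t τ

/-- The point `z` has a spasmodic Zeno trajectory: the sequence of the states at its successive
reset times (the sequence `t` lists all of them) escapes every compact set. -/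
def IsSpasmodicZeno (z : N) : Prop :=
  ∃ γ t τ, 𝓗.IsZenoExecution z γ t τ ∧
    (∀ s ∈ Ico 0 τ, γ s ∈ 𝓗.guard → s ∈ range t) ∧
    Tendsto (fun i => γ (t i)) atTop (cocompact N)

/-- The set `𝒩` of the points that have a steady, i.e. not spasmodic, Zeno trajectory. -/
def steadyZenoSet : Set N := {z | 𝓗.IsZeno z ∧ ¬ 𝓗.IsSpasmodicZeno z}

end HybridDynamicalSystem

end Hybrid

/-! ### Basic neighbourhoods in the strong (Whitney) `C^∞` topology -/

section Whitney

variable {E : Type*} [NormedAddCommGroup E] [NormedSpace ℝ E]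
  {H : Type*} [TopologicalSpace H] (I : ModelWithCorners ℝ E H)
  {P : Type*} [TopologicalSpace P] [ChartedSpace H P]
  {E' : Type*} [NormedAddCommGroup E'] [NormedSpace ℝ E']
  {H' : Type*} [TopologicalSpace H'] (I' : ModelWithCorners ℝ E' H')
  {N : Type*} [TopologicalSpace N] [ChartedSpace H' N]

/-- The data of a basic neighbourhood of `f : P → N` in the strong (Whitney) `C^∞` topology:
an order `k`, a locally finite family of compact sets `K a ⊆ P`, charts of `P` around `K a` and of
`N` around `f (K a)`, and positive numbers `ε a`. -/
structure WhitneyNhd (f : P → N) where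
  k : ℕ
  K : ℕ → Set P
  isCompact : ∀ a, IsCompact (K a)
  locallyFinite : LocallyFinite K
  chartP : ℕ → OpenPartialHomeomorph P H
  chartP_mem : ∀ a, chartP a ∈ IsManifold.maximalAtlas I ∞ P
  subset_source : ∀ a, K a ⊆ (chartP a).source
  chartN : ℕ → OpenPartialHomeomorph N H'
  chartN_mem : ∀ a, chartN a ∈ IsManifold.maximalAtlas I' ∞ N
  mapsTo : ∀ a, MapsTo f (K a) (chartN a).source
  ε : ℕ → ℝ
  ε_pos : ∀ a, 0 < ε a

namespace WhitneyNhd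

variable {I I'} {f : P → N}

/-- The map `g` in the `a`-th pair of charts. -/
def inCharts (𝒰 : WhitneyNhd I I' f) (a : ℕ) (g : P → N) : E → E' :=
  (𝒰.chartN a).extend I' ∘ g ∘ ((𝒰.chartP a).extend I).symm

/-- The smooth map `g` belongs to the basic neighbourhood `𝒰` of `f`: over each `K a` the partial
derivatives of `g` of order at most `k` in the charts differ from those of `f` by less than
`ε a`. -/
def Contains (𝒰 : WhitneyNhd I I' f) (g : P → N) : Prop :=
  ContMDiff I I' ∞ g ∧ ∀ a, MapsTo g (𝒰.K a) (𝒰.chartN a).source ∧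
    ∀ m ≤ 𝒰.k, ∀ y ∈ (𝒰.chartP a).extend I '' 𝒰.K a,
      ‖iteratedFDeriv ℝ m (𝒰.inCharts a g) y - iteratedFDeriv ℝ m (𝒰.inCharts a f) y‖ < 𝒰.ε a

end WhitneyNhd

end Whitney

/-! ### The cotangent bundle and hybrid Hamiltonian systems -/

section Cotangent

/-- The model space `ℝⁿ`. -/
abbrev RSpace (n : ℕ) : Type := EuclideanSpace ℝ (Fin n)

/-- The dual of the model space. -/
abbrev RDual (n : ℕ) : Type := RSpace n →L[ℝ] ℝ

variable (n : ℕ) (M : Type*) [TopologicalSpace M] [ChartedSpace (RSpace n) M]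
  [IsManifold (𝓡 n) ∞ M]

/-- The cotangent bundle `T^*M`, with Mathlib's structure of a smooth vector bundle. -/
abbrev CotangentBundle : Type _ :=
  Bundle.TotalSpace (RDual n) (fun x : M => TangentSpace (𝓡 n) x →L[ℝ] Bundle.Trivial M ℝ x)

/-- The model with corners of the manifold `T^*M`. -/
abbrev cotangentModel : ModelWithCorners ℝ (RSpace n × RDual n) (ModelProd (RSpace n) (RDual n)) :=
  (𝓡 n).prod 𝓘(ℝ, RDual n)

variable {n M}

/-- The differential `df_x : T_x M → ℝ` of a function on `M`. -/
def differential (f : M → ℝ) (x : M) : TangentSpace (𝓡 n) x →L[ℝ] ℝ :=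
  mfderiv (𝓡 n) 𝓘(ℝ, ℝ) f x

/-- The derivative `T_z T^*M → T_{π z} M` of the projection `π : T^*M → M`. -/
def dproj (z : CotangentBundle n M) :
    TangentSpace (cotangentModel n) z →L[ℝ] TangentSpace (𝓡 n) z.proj :=
  mfderiv (cotangentModel n) (𝓡 n) (Bundle.TotalSpace.proj : CotangentBundle n M → M) z

/-- The tautological one-form `ϑ = p_i dx^i` on `T^*M`. -/
def tautologicalForm (z : CotangentBundle n M) (v : TangentSpace (cotangentModel n) z) : ℝ :=
  z.2 (dproj z v)

/-- The action form `ϑ_H = p_i dx^i - H dt` on `ℝ × T^*M` at a point `(t, z)` (it does not depend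
on `t`), applied to the tangent vector `(a, v)`. -/
def actionForm (H : CotangentBundle n M → ℝ) (z : CotangentBundle n M) (a : ℝ)
    (v : TangentSpace (cotangentModel n) z) : ℝ :=
  tautologicalForm z v - H z * a

/-- The canonical symplectic form `ω = -dϑ = dx^i ∧ dp_i` on `T^*M`. By definition the tangent
space at `z` is `ℝⁿ × (ℝⁿ)^*`, by means of the chart at `z`; this is the chart of `T^*M` with the
canonical coordinates `(x^i, p_i)` that belong to the chart of `M` at `π z`. -/
def symplecticForm (z : CotangentBundle n M) (u v : TangentSpace (cotangentModel n) z) : ℝ :=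
  let u' : RSpace n × RDual n := u
  let v' : RSpace n × RDual n := v
  v'.2 u'.1 - u'.2 v'.1

/-- `X` is the Hamiltonian vector field of `H`, i.e. `i_X ω = dH`. -/
def IsHamiltonianVectorField (H : CotangentBundle n M → ℝ)
    (X : (z : CotangentBundle n M) → TangentSpace (cotangentModel n) z) : Prop :=
  ∀ z v, symplecticForm z (X z) v = mfderiv (cotangentModel n) 𝓘(ℝ, ℝ) H z v

/-- `i : P → T^*M` is a smooth embedding of an `n`-dimensional manifold with `i^*ω = 0`, so that
its image is an (embedded) Lagrangian submanifold of `T^*M`. -/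
structure IsLagrangianEmbedding {P : Type*} [TopologicalSpace P] [ChartedSpace (RSpace n) P]
    (i : P → CotangentBundle n M) : Prop where
  isSmoothEmbedding : Manifold.IsSmoothEmbedding (𝓡 n) (cotangentModel n) ∞ i
  isotropic : ∀ (q : P) (u v : TangentSpace (𝓡 n) q),
    symplecticForm (i q) (mfderiv (𝓡 n) (cotangentModel n) i q u)
      (mfderiv (𝓡 n) (cotangentModel n) i q v) = 0

variable (n M) in
/-- A hybrid Hamiltonian system `(T^*M, S^*, X_H, Δ̃)`: the lift of a guard `S ⊆ M` and a reset
`Δ : S → M` to the cotangent bundle by means of a Hamiltonian `H`. The guard `S` is the zero set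
of a function `h` without critical zeros that is defined on an open set containing `S`. -/
structure HybridHamiltonianSystem where
  /-- the domain of the function `h` -/
  dom : Set M
  isOpen_dom : IsOpen dom
  /-- the defining function of the guard `S` -/
  h : M → ℝ
  smooth_h : ContMDiffOn (𝓡 n) 𝓘(ℝ, ℝ) ∞ h dom
  dh_ne_zero : ∀ x ∈ dom, h x = 0 → differential (n := n) h x ≠ 0
  /-- the reset `Δ` on `M`; its values outside `S` are irrelevant -/
  Δ : M → M
  isGuardReset : IsGuardReset (𝓡 n) {x | x ∈ dom ∧ h x = 0} Δ
  /-- the Hamiltonian -/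
  H : CotangentBundle n M → ℝ
  smooth_H : ContMDiff (cotangentModel n) 𝓘(ℝ, ℝ) ∞ H
  /-- the hybrid dynamical system `(T^*M, S^*, X_H, Δ̃)` -/
  lift : HybridDynamicalSystem (cotangentModel n) (CotangentBundle n M)
  field_eq : IsHamiltonianVectorField H lift.field
  /-- `S^*` is the extended guard, consisting of the outward pointing momenta over `S`. -/
  guard_eq : lift.guard = {z | (z.proj ∈ dom ∧ h z.proj = 0) ∧
    0 < differential h z.proj (dproj z (lift.field z))}
  /-- `Δ̃` covers `Δ`. -/
  proj_reset : ∀ z ∈ lift.guard, (lift.reset z).proj = Δ z.proj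
  /-- `(Id × Δ̃)^* ϑ_H = ι^* ϑ_H` on `ℝ × S^*`. The vectors `v` with `dh (dπ v) = 0` are those
  tangent to `S^*`, and on these every derivative of `Δ̃` within `S^*` has the same value. -/
  reset_pullback : ∀ z ∈ lift.guard, ∀ (a : ℝ) (v : TangentSpace (cotangentModel n) z),
    differential h z.proj (dproj z v) = 0 →
    actionForm H (lift.reset z) a
        (mfderivWithin (cotangentModel n) (cotangentModel n) lift.reset lift.guard z v) =
      actionForm H z a v

namespace HybridHamiltonianSystem

variable (𝓗 : HybridHamiltonianSystem n M)

/-- The system has no spasmodic Zeno trajectories. -/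
def FreeOfSpasmodicZeno : Prop := ∀ z, ¬ 𝓗.lift.IsSpasmodicZeno z

/-- The fiber `T_x^*M` contains almost no points with a steady Zeno trajectory. The null sets of
the smooth measures on the vector space `T_x^*M` are those of its Haar (Lebesgue) measures. -/
def AlmostNoSteadyZeno (x : M) : Prop :=
  ∀ μ : MeasureTheory.Measure (RDual n), μ.IsAddHaarMeasure →
    μ {p : RDual n | (⟨x, p⟩ : CotangentBundle n M) ∈ 𝓗.lift.steadyZenoSet} = 0

/-- The set `V_x = T_x^*M \ 𝒩`. -/
def nonZenoFiber (x : M) : Set (CotangentBundle n M) :=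
  {z | z.proj = x} \ 𝓗.lift.steadyZenoSet

end HybridHamiltonianSystem

end Cotangent

end

noncomputable section

/-! ### Symplectic linear algebra and shears of `ℝⁿ × (ℝⁿ)^*` -/

/-! A closure point of `φ_T(V_x)` on `𝓛` has points of `φ_T(V_x)` arbitrarily near it. So it
suffices to show that every point `z` close enough to a given point `i q` of `𝓛` lies on a
Lagrangian submanifold in the prescribed Whitney neighbourhood
(`IsLagrangianEmbedding.eventually_exists_contains`).

This is a local construction in canonical coordinates `(x, p)`. Some tilted fibre direction `{(-s
p^♯, p)}` is transverse to `𝓛` at `i q` (`exists_injective_tilt`), so near `i q` the function `X = x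
+ s p^♯` is a coordinate system on `𝓛`. Exactly one point of that piece of `𝓛` has the same value of
`X` as `z`, and a translation along the tilted fibre, by a covector `c` that tends to `0` as `z → i
q`, carries it to `z`. To localise the translation, the constant form `c` is replaced by the exact
form `d(χ c)` with a bump function `χ`. The resulting shear is still symplectic
(`stdForm_fderiv_tiltedShear`) because that form is closed.

The perturbed map equals `i` outside a compact set and depends smoothly on `c`. For small `c` it is
therefore Whitney close to `i` (`WhitneyNhd.eventually_contains`) and still an embedding
(`Topology.IsEmbedding.of_eqOn_compl_of_eqOn`). That canonical charts carry the symplectic form to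
the standard one is `stdForm_mfderiv_extChartAt`. -/

/-- The standard symplectic form on `ℝⁿ × (ℝⁿ)^*`. -/
def stdForm {n : ℕ} (u v : RSpace n × RDual n) : ℝ := v.2 u.1 - u.2 v.1

/-- The identification of `(ℝⁿ)^*` with `ℝⁿ` by the Euclidean inner product. -/
def sharp (n : ℕ) : RDual n →L[ℝ] RSpace n :=
  LinearMap.toContinuousLinearMap
    { toFun := fun p => (InnerProductSpace.toDual ℝ (RSpace n)).symm p
      map_add' := fun p q => by simp
      map_smul' := fun c p => by simp }

theorem inner_sharp {n : ℕ} (p : RDual n) (x : RSpace n) : inner ℝ (sharp n p) x = p x :=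
  InnerProductSpace.toDual_symm_apply

theorem apply_sharp_comm {n : ℕ} (p q : RDual n) : p (sharp n q) = q (sharp n p) := by
  rw [← inner_sharp, ← inner_sharp, real_inner_comm]

theorem sharp_eq_zero {n : ℕ} {p : RDual n} (h : sharp n p = 0) : p = 0 := by
  ext x
  rw [← inner_sharp, h]
  simp

/-- The image of an injective isotropic map is transverse to the Lagrangian plane
`{(-s p^♯, p)}` for some `s`. -/
theorem exists_injective_tilt {n : ℕ} (f : RSpace n →L[ℝ] RSpace n × RDual n)
    (hf : Function.Injective f) (hiso : ∀ u v, stdForm (f u) (f v) = 0) :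
    ∃ s : ℝ, Function.Injective fun v => (f v).1 + s • sharp n (f v).2 := by
  -- If every `s` fails, each `s` has a kernel vector `v s ≠ 0`. Its covector part `p_s` is nonzero
  -- by injectivity of `f`, and isotropy gives `(t - s) ⟨p_s, p_t⟩ = 0`. This would make infinitely
  -- many nonzero vectors of `ℝⁿ` pairwise orthogonal.
  by_contra! H
  have key : ∀ s : ℝ, ∃ v, v ≠ 0 ∧ (f v).1 + s • sharp n (f v).2 = 0 := by
    intro s
    obtain ⟨a, b, hab, hne⟩ := Function.not_injective_iff.1 (H s)
    refine ⟨a - b, sub_ne_zero.2 hne, ?_⟩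
    simp only [map_sub, Prod.fst_sub, Prod.snd_sub, smul_sub] at hab ⊢
    rw [← sub_eq_zero] at hab
    rw [← hab]
    abel
  choose v hv0 hv using key
  have hne : ∀ s, sharp n (f (v s)).2 ≠ 0 := by
    intro s h
    have h1 : (f (v s)).1 = 0 := by simpa [h] using hv s
    exact hv0 s (hf (by rw [map_zero]; exact Prod.ext h1 (sharp_eq_zero h)))
  have horth : Pairwise fun s t : ℝ =>
      inner ℝ (sharp n (f (v s)).2) (sharp n (f (v t)).2) = 0 := by
    intro s t hst
    have h := hiso (v s) (v t)
    have h1 : (f (v s)).1 = -(s • sharp n (f (v s)).2) := eq_neg_of_add_eq_zero_left (hv s)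
    have h2 : (f (v t)).1 = -(t • sharp n (f (v t)).2) := eq_neg_of_add_eq_zero_left (hv t)
    rw [stdForm, h1, h2, map_neg, map_neg, map_smul, map_smul,
      apply_sharp_comm (f (v t)).2 (f (v s)).2, smul_eq_mul, smul_eq_mul] at h
    rw [inner_sharp]
    have h3 : (t - s) * (f (v s)).2 (sharp n (f (v t)).2) = 0 := by linarith
    exact (mul_eq_zero.1 h3).resolve_left (sub_ne_zero.2 hst.symm)
  have hli : LinearIndependent ℝ fun s : ℝ => sharp n (f (v s)).2 :=
    linearIndependent_of_ne_zero_of_inner_eq_zero hne horth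
  exact not_finite_iff_infinite.2 inferInstance hli.finite

/-- The conjugate of the shear `(x, p) ↦ (x, p + σ x)` by the linear symplectic map
`(x, p) ↦ (x + s p^♯, p)`. -/
def tiltedShear {n : ℕ} (s : ℝ) (σ : RSpace n → RDual n) (z : RSpace n × RDual n) :
    RSpace n × RDual n :=
  (z.1 - s • sharp n (σ (z.1 + s • sharp n z.2)), z.2 + σ (z.1 + s • sharp n z.2))

/-- The two changes `-s σ^♯` and `s σ^♯` cancel. Since `σ` is evaluated at this invariant
coordinate, the shear along `-σ` is the inverse. -/
theorem tiltedShear_tilt {n : ℕ} (s : ℝ) (σ : RSpace n → RDual n) (z : RSpace n × RDual n) :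
    (tiltedShear s σ z).1 + s • sharp n (tiltedShear s σ z).2 = z.1 + s • sharp n z.2 := by
  simp only [tiltedShear, map_add, smul_add]
  abel

theorem tiltedShear_of_eq_zero {n : ℕ} {s : ℝ} {σ : RSpace n → RDual n} {z : RSpace n × RDual n}
    (h : σ (z.1 + s • sharp n z.2) = 0) : tiltedShear s σ z = z := by
  simp [tiltedShear, h]

theorem tiltedShear_neg_tiltedShear {n : ℕ} (s : ℝ) (σ : RSpace n → RDual n)
    (z : RSpace n × RDual n) : tiltedShear s (-σ) (tiltedShear s σ z) = z := by
  rw [tiltedShear, tiltedShear_tilt]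
  simp [tiltedShear]

theorem ContDiff.tiltedShear {n : ℕ} (s : ℝ) {σ : RSpace n → RDual n} (hσ : ContDiff ℝ ∞ σ) :
    ContDiff ℝ ∞ (tiltedShear s σ) := by
  unfold _root_.tiltedShear
  fun_prop

/-- The tilted shear as a homeomorphism. -/
def tiltedShearHomeomorph {n : ℕ} (s : ℝ) (σ : RSpace n → RDual n) (hσ : ContDiff ℝ ∞ σ) :
    RSpace n × RDual n ≃ₜ RSpace n × RDual n where
  toFun := tiltedShear s σ
  invFun := tiltedShear s (-σ)
  left_inv z := tiltedShear_neg_tiltedShear s σ z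
  right_inv z := by simpa using tiltedShear_neg_tiltedShear s (-σ) z
  continuous_toFun := (hσ.tiltedShear s).continuous
  continuous_invFun := (hσ.neg.tiltedShear s).continuous

/-- A tilted shear along a closed one-form is symplectic. -/
theorem stdForm_fderiv_tiltedShear {n : ℕ} (s : ℝ) {σ : RSpace n → RDual n}
    (z : RSpace n × RDual n) (hσ : DifferentiableAt ℝ σ (z.1 + s • sharp n z.2))
    (hsymm : ∀ a b, fderiv ℝ σ (z.1 + s • sharp n z.2) a b =
      fderiv ℝ σ (z.1 + s • sharp n z.2) b a) (a b : RSpace n × RDual n) :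
    stdForm (fderiv ℝ (tiltedShear s σ) z a) (fderiv ℝ (tiltedShear s σ) z b) = stdForm a b := by
  set D := fderiv ℝ σ (z.1 + s • sharp n z.2)
  let l : RSpace n × RDual n →L[ℝ] RSpace n :=
    .fst ℝ _ _ + s • (sharp n ∘L .snd ℝ _ _)
  have hl : HasFDerivAt (fun z : RSpace n × RDual n => z.1 + s • sharp n z.2) l z :=
    l.hasFDerivAt
  have hc : HasFDerivAt (fun z : RSpace n × RDual n => σ (z.1 + s • sharp n z.2)) (D ∘L l) z :=
    HasFDerivAt.comp z hσ.hasFDerivAt hl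
  have hT : HasFDerivAt (tiltedShear s σ)
      ((ContinuousLinearMap.fst ℝ _ _ - s • (sharp n ∘L (D ∘L l))).prod
        (ContinuousLinearMap.snd ℝ _ _ + D ∘L l)) z := by
    refine HasFDerivAt.prodMk ?_ (hasFDerivAt_snd.add hc)
    exact hasFDerivAt_fst.sub (((sharp n).hasFDerivAt.comp z hc).const_smul s)
  -- The terms quadratic in `D` cancel by symmetry of the pairing through `sharp`. The remaining
  -- ones add up to `D (l b) (l a) - D (l a) (l b)`, which vanishes since `σ` is closed.
  have h1 := hsymm (l a) (l b)
  have h2 := apply_sharp_comm (D (l a)) (D (l b))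
  have h3 := apply_sharp_comm (D (l b)) a.2
  have h4 := apply_sharp_comm (D (l a)) b.2
  have h5 : D (l b) (l a) = D (l b) a.1 + s * D (l b) (sharp n a.2) := by
    rw [← smul_eq_mul, ← map_smul, ← map_add]; rfl
  have h6 : D (l a) (l b) = D (l a) b.1 + s * D (l a) (sharp n b.2) := by
    rw [← smul_eq_mul, ← map_smul, ← map_add]; rfl
  rw [hT.fderiv]
  simp only [stdForm, ContinuousLinearMap.prod_apply, add_apply,
    sub_apply, smul_apply, ContinuousLinearMap.comp_apply,
    ContinuousLinearMap.coe_fst', ContinuousLinearMap.coe_snd', map_sub, map_smul, smul_eq_mul]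
  linear_combination s * h2 + h6 - h5 - h1 - s * h3 + s * h4

/-! ### Cut-off constant one-forms -/

/-- The differential of the cut-off linear function `χ c`. -/
def cutoffForm {n : ℕ} (χ : RSpace n → ℝ) (c : RDual n) (x : RSpace n) : RDual n :=
  χ x • c + c x • fderiv ℝ χ x

/-- Joint smoothness in `c` and `x` is what later makes all derivatives of the perturbation small
together with `c`. -/
theorem contDiff_cutoffForm {n : ℕ} {χ : RSpace n → ℝ} (hχ : ContDiff ℝ ∞ χ) :
    ContDiff ℝ ∞ fun q : RDual n × RSpace n => cutoffForm χ q.1 q.2 := by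
  have h : ContDiff ℝ ∞ (fderiv ℝ χ) := hχ.fderiv_right (by simp)
  unfold cutoffForm
  fun_prop

theorem fderiv_cutoff {n : ℕ} {χ : RSpace n → ℝ} (hχ : ContDiff ℝ ∞ χ) (c : RDual n) :
    fderiv ℝ (fun x => χ x * c x) = cutoffForm χ c := by
  ext1 x
  exact ((hχ.differentiable (by simp) x).hasFDerivAt.mul c.hasFDerivAt).fderiv

/-- The form is exact, so its derivative is a second derivative of `χ c`. -/
theorem fderiv_cutoffForm_symm {n : ℕ} {χ : RSpace n → ℝ} (hχ : ContDiff ℝ ∞ χ) (c : RDual n)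
    (x a b : RSpace n) : fderiv ℝ (cutoffForm χ c) x a b = fderiv ℝ (cutoffForm χ c) x b a := by
  rw [← fderiv_cutoff hχ]
  have h : ContDiff ℝ ∞ fun x => χ x * c x := by fun_prop
  exact (h.contDiffAt.isSymmSndFDerivAt (by
    rw [minSmoothness_of_isRCLikeNormedField]; exact ENat.LEInfty.out)) a b

theorem cutoffForm_zero {n : ℕ} (χ : RSpace n → ℝ) : cutoffForm χ 0 = 0 := by
  ext x
  simp [cutoffForm]

theorem cutoffForm_of_notMem_tsupport {n : ℕ} {χ : RSpace n → ℝ} (c : RDual n) {x : RSpace n}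
    (hx : x ∉ tsupport χ) : cutoffForm χ c x = 0 := by
  have h := notMem_tsupport_iff_eventuallyEq.1 hx
  have h' : fderiv ℝ χ x = 0 := by rw [h.fderiv_eq]; exact fderiv_const_apply 0
  simp [cutoffForm, h.eq_of_nhds, h']

/-- Where `χ` is locally `1` the shear is thus the exact translation by `c` along the tilted fibres.
-/
theorem cutoffForm_of_eventuallyEq_one {n : ℕ} {χ : RSpace n → ℝ} (c : RDual n) {x : RSpace n}
    (hx : χ =ᶠ[𝓝 x] 1) : cutoffForm χ c x = c := by
  have h' : fderiv ℝ χ x = 0 := by rw [hx.fderiv_eq]; exact fderiv_const_apply 1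
  simp [cutoffForm, hx.eq_of_nhds, h']

/-! ### Partial derivatives of smooth families -/

/-- The derivatives are taken in `y` only, with `c` as a parameter. Their joint continuity gives the
Whitney estimates. -/
theorem ContDiffAt.iteratedFDeriv_uncurry {X E F : Type*} [NormedAddCommGroup X] [NormedSpace ℝ X]
    [NormedAddCommGroup E] [NormedSpace ℝ E] [NormedAddCommGroup F] [NormedSpace ℝ F]
    {G : X → E → F} {c : X} {y : E} (hG : ContDiffAt ℝ ∞ (Function.uncurry G) (c, y)) (m : ℕ) :
    ContDiffAt ℝ ∞ (fun q : X × E => iteratedFDeriv ℝ m (G q.1) q.2) (c, y) := by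
  induction m with
  | zero =>
    exact (continuousMultilinearCurryFin0 ℝ E F).symm.contDiff.contDiffAt.comp (c, y) hG
  | succ m ih =>
    have h : ContDiffAt ℝ ∞ (fun q : X × E => fderiv ℝ (iteratedFDeriv ℝ m (G q.1)) q.2) (c, y) :=
      ContDiffAt.fderiv (f := fun (q : X × E) (v : E) => iteratedFDeriv ℝ m (G q.1) v)
        (g := Prod.snd) (x₀ := (c, y)) (n := ∞)
        (ContDiffAt.comp ((c, y), y) (f := fun r : (X × E) × E => (r.1.1, r.2)) ih
          (by fun_prop)) contDiffAt_snd (by simp)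
    exact (continuousMultilinearCurryLeftEquiv ℝ
      (fun _ : Fin (m + 1) => E) F).symm.contDiff.contDiffAt.comp (c, y) h

/-! ### Charts of the cotangent bundle are symplectic -/

/-- The cotangent lift of a diffeomorphism is symplectic. -/
theorem stdForm_fderiv_cotangentLift {n : ℕ} {τ : RSpace n → RSpace n}
    {B : RSpace n → RSpace n →L[ℝ] RSpace n} {x : RSpace n} (p : RDual n)
    (hτ : ContDiffAt ℝ 2 τ x) (hB : DifferentiableAt ℝ B x)
    (hBτ : ∀ᶠ y in 𝓝 x, ∀ v, B y (fderiv ℝ τ y v) = v) (a b : RSpace n × RDual n) :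
    stdForm (fderiv ℝ (fun q : RSpace n × RDual n => (τ q.1, q.2 ∘L B q.1)) (x, p) a)
      (fderiv ℝ (fun q : RSpace n × RDual n => (τ q.1, q.2 ∘L B q.1)) (x, p) b) =
      stdForm a b := by
  have hdτ : DifferentiableAt ℝ (fderiv ℝ τ) x :=
    (hτ.fderiv_right (m := 1) (by norm_num)).differentiableAt (by simp)
  have h1 : HasFDerivAt (fun q : RSpace n × RDual n => τ q.1)
      (fderiv ℝ τ x ∘L .fst ℝ _ _) (x, p) :=
    HasFDerivAt.comp (x, p) (g := τ) (hτ.differentiableAt (by simp)).hasFDerivAt hasFDerivAt_fst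
  have h2 : HasFDerivAt (fun q : RSpace n × RDual n => B q.1)
      (fderiv ℝ B x ∘L .fst ℝ _ _) (x, p) :=
    HasFDerivAt.comp (x, p) (g := B) hB.hasFDerivAt hasFDerivAt_fst
  have hT := h1.prodMk ((hasFDerivAt_snd (p := (x, p))).clm_comp h2)
  have hx := hBτ.self_of_nhds
  -- Differentiate the identity `B ∘ τ' = id`. This trades the derivative of `B` for the second
  -- derivative of `τ`, whose symmetry gives the claim.
  have hD : ∀ u v, B x (fderiv ℝ (fderiv ℝ τ) x u v) + fderiv ℝ B x u (fderiv ℝ τ x v) = 0 := by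
    intro u v
    have h3 := (hB.hasFDerivAt.clm_comp hdτ.hasFDerivAt).congr_of_eventuallyEq
      (f₁ := fun _ => ContinuousLinearMap.id ℝ (RSpace n)) (by
        filter_upwards [hBτ] with y hy
        ext1 w
        exact (hy w).symm)
    have h4 := h3.unique (hasFDerivAt_const _ x)
    simpa using DFunLike.congr_fun (DFunLike.congr_fun h4 u) v
  have hs := (hτ.isSymmSndFDerivAt (by simp [minSmoothness_of_isRCLikeNormedField])) a.1 b.1
  have e1 := congrArg p (hD a.1 b.1)
  have e2 := congrArg p (hD b.1 a.1)
  rw [map_add, map_zero] at e1 e2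
  rw [hT.fderiv]
  simp only [stdForm, ContinuousLinearMap.prod_apply, add_apply, ContinuousLinearMap.comp_apply,
    ContinuousLinearMap.coe_fst', ContinuousLinearMap.coe_snd', ContinuousLinearMap.compL_apply,
    ContinuousLinearMap.flip_apply, hx]
  rw [hs] at e1
  linear_combination e2 - e1

section

variable {n : ℕ} {M : Type*} [TopologicalSpace M] [ChartedSpace (RSpace n) M]
  [IsManifold (𝓡 n) ∞ M]

theorem mem_cotangent_chart_source {z w : CotangentBundle n M} :
    z ∈ (extChartAt (cotangentModel n) w).source ↔
      z.proj ∈ (extChartAt (𝓡 n) w.proj).source := by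
  rw [FiberBundle.extChartAt]
  have h : z ∈ (trivializationAt (RDual n)
      (fun x : M => TangentSpace (𝓡 n) x →L[ℝ] Bundle.Trivial M ℝ x) w.proj).source ↔
      z.proj ∈ (chartAt (RSpace n) w.proj).source := by
    rw [hom_trivializationAt_source]
    exact ⟨fun h => h.1, fun h => ⟨h, mem_univ _⟩⟩
  rw [PartialEquiv.trans_source, mem_inter_iff, h, extChartAt_source]
  refine and_iff_left_of_imp fun hz => ⟨?_, mem_univ _⟩
  rw [extChartAt_source]
  exact hz

/-- The canonical coordinates on the cotangent bundle. -/
theorem cotangent_extChartAt_apply {z w : CotangentBundle n M}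
    (hz : z ∈ (extChartAt (cotangentModel n) w).source) :
    extChartAt (cotangentModel n) w z =
      (extChartAt (𝓡 n) w.proj z.proj,
        (z.2 : RDual n) ∘L tangentCoordChange (𝓡 n) w.proj z.proj z.proj) := by
  have hz' := mem_cotangent_chart_source.1 hz
  rw [extChartAt_source] at hz'
  have h := hom_chart (HB := RSpace n) (𝕜 := ℝ) w z
  rw [ContinuousLinearMap.inCoordinates, TangentBundle.symmL_trivializationAt_eq_core hz'] at h
  refine h.trans ?_
  refine Prod.ext rfl ?_
  ext v
  simp [Bundle.Trivial.continuousLinearMapAt_trivialization]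

theorem tangentCoordChange_eq_fderiv {x y z : M} : tangentCoordChange (𝓡 n) x y z =
    fderiv ℝ (extChartAt (𝓡 n) y ∘ (extChartAt (𝓡 n) x).symm) (extChartAt (𝓡 n) x z) := by
  rw [tangentCoordChange_def]
  simp [fderivWithin_univ]

/-- In the chart at `w` the symplectic form at a nearby point `z` is the standard one. -/
theorem stdForm_mfderiv_extChartAt {z w : CotangentBundle n M}
    (hz : z ∈ (extChartAt (cotangentModel n) w).source)
    (u v : TangentSpace (cotangentModel n) z) :
    stdForm (mfderiv (cotangentModel n) 𝓘(ℝ, RSpace n × RDual n)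
        (extChartAt (cotangentModel n) w) z u)
      (mfderiv (cotangentModel n) 𝓘(ℝ, RSpace n × RDual n)
        (extChartAt (cotangentModel n) w) z v) = symplecticForm z u v := by
  have hz' := mem_cotangent_chart_source.1 hz
  set φz := extChartAt (𝓡 n) z.proj with hφz
  set φw := extChartAt (𝓡 n) w.proj with hφw
  set x₀ := φz z.proj with hx₀
  have hzs : z.proj ∈ φz.source := mem_extChartAt_source _
  let τ : RSpace n → RSpace n := φw ∘ φz.symm
  let B : RSpace n → RSpace n →L[ℝ] RSpace n := fun y =>
    tangentCoordChange (𝓡 n) w.proj z.proj (φz.symm y)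
  have hx₀t : x₀ ∈ φz.target := φz.map_source hzs
  have hnear : ∀ᶠ y in 𝓝 x₀, y ∈ φz.target ∧ φz.symm y ∈ φw.source := by
    have h1 : ContinuousAt φz.symm x₀ := continuousAt_extChartAt_symm z.proj
    refine Filter.Eventually.and (extChartAt_target_mem_nhds z.proj) (h1 ?_)
    rw [hx₀, φz.left_inv hzs]
    exact extChartAt_source_mem_nhds' hz'
  have hsm : ∀ {a b : M} {y : RSpace n}, y ∈ (extChartAt (𝓡 n) a).target →
      (extChartAt (𝓡 n) a).symm y ∈ (extChartAt (𝓡 n) b).source →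
      ContDiffAt ℝ ∞ (extChartAt (𝓡 n) b ∘ (extChartAt (𝓡 n) a).symm) y := by
    intro a b y h1 h2
    have := contDiffWithinAt_ext_coord_change (I := 𝓡 n) (n := ∞) b a (y := y) ⟨h1, h2⟩
    simpa [contDiffWithinAt_univ] using this
  have hτ : ContDiffAt ℝ ∞ τ x₀ := hsm hnear.self_of_nhds.1 hnear.self_of_nhds.2
  have hB : DifferentiableAt ℝ B x₀ := by
    have h1 : B = fun y => fderiv ℝ (φz ∘ φw.symm) (τ y) := by
      ext1 y
      exact tangentCoordChange_eq_fderiv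
    have h2 : ContDiffAt ℝ ∞ (φz ∘ φw.symm) (τ x₀) := by
      refine hsm (φw.map_source hnear.self_of_nhds.2) ?_
      change φw.symm (φw (φz.symm x₀)) ∈ _
      rw [φw.left_inv hnear.self_of_nhds.2]
      exact φz.map_target hx₀t
    rw [h1]
    have h3 := h2.fderiv_right (m := 1) (by rw [one_add_one_eq_two]; exact ENat.LEInfty.out)
    exact (h3.differentiableAt (by simp)).comp x₀
      (hτ.differentiableAt (by simp))
  have hBτ : ∀ᶠ y in 𝓝 x₀, ∀ v, B y (fderiv ℝ τ y v) = v := by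
    filter_upwards [hnear] with y hy v
    have h1 : fderiv ℝ τ y = tangentCoordChange (𝓡 n) z.proj w.proj (φz.symm y) := by
      rw [tangentCoordChange_eq_fderiv, ← hφz, φz.right_inv hy.1]
    have hys := φz.map_target hy.1
    rw [h1]
    exact (tangentCoordChange_comp ⟨⟨hys, hy.2⟩, hys⟩).trans (tangentCoordChange_self hys)
  -- `symplecticForm` at `z` is read in the chart at `z`, so the two charts have to be compared.
  -- Their transition map is the cotangent lift of the transition map `τ` on `M`, with `B` the
  -- inverse of its derivative.
  have hwr : extChartAt (cotangentModel n) w ∘ (extChartAt (cotangentModel n) z).symm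
      =ᶠ[𝓝 (extChartAt (cotangentModel n) z z)]
      fun q : RSpace n × RDual n => (τ q.1, q.2 ∘L B q.1) := by
    have h1 : ∀ᶠ q in 𝓝 (extChartAt (cotangentModel n) z z),
        q ∈ (extChartAt (cotangentModel n) z).target ∧
          (extChartAt (cotangentModel n) z).symm q ∈ (extChartAt (cotangentModel n) w).source := by
      refine Filter.Eventually.and (extChartAt_target_mem_nhds z)
        (continuousAt_extChartAt_symm z ?_)
      rw [extChartAt_to_inv]
      exact extChartAt_source_mem_nhds' hz
    filter_upwards [h1] with q hq
    obtain ⟨hq1, hq2⟩ := hq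
    have hq3 := (extChartAt (cotangentModel n) z).map_target hq1
    have hq4 := (extChartAt (cotangentModel n) z).right_inv hq1
    rw [Function.comp_apply]
    set y := (extChartAt (cotangentModel n) z).symm q
    have e1 := cotangent_extChartAt_apply hq3
    have e2 := cotangent_extChartAt_apply hq2
    have b1 := mem_cotangent_chart_source.1 hq3
    have b2 := mem_cotangent_chart_source.1 hq2
    rw [hq4] at e1
    have e3 : φz.symm q.1 = y.proj := by rw [e1]; exact φz.left_inv b1
    rw [e2]
    refine Prod.ext ?_ ?_
    · change φw y.proj = φw (φz.symm q.1)
      rw [e3]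
    · change _ = q.2 ∘L tangentCoordChange (𝓡 n) w.proj z.proj (φz.symm q.1)
      rw [e3, e1]
      ext v
      change (y.2 : RDual n) _ = (y.2 : RDual n) _
      congr 1
      exact (tangentCoordChange_comp ⟨⟨b2, b1⟩, mem_extChartAt_source _⟩).symm
  have hd : MDifferentiableAt (cotangentModel n) 𝓘(ℝ, RSpace n × RDual n)
      (extChartAt (cotangentModel n) w) z :=
    (contMDiffAt_extChartAt' (n := 1)
      (by rwa [← extChartAt_source (cotangentModel n)])).mdifferentiableAt (by simp)
  have hm : mfderiv (cotangentModel n) 𝓘(ℝ, RSpace n × RDual n)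
      (extChartAt (cotangentModel n) w) z =
      fderiv ℝ (fun q : RSpace n × RDual n => (τ q.1, q.2 ∘L B q.1))
        (extChartAt (cotangentModel n) z z) := by
    rw [hd.mfderiv, ← hwr.fderiv_eq]
    rw [ModelWithCorners.range_eq_univ, fderivWithin_univ]
    rfl
  have hpt : extChartAt (cotangentModel n) z z = (x₀, (extChartAt (cotangentModel n) z z).2) := by
    refine Prod.ext ?_ rfl
    rw [cotangent_extChartAt_apply (mem_extChartAt_source z)]
  rw [hm, hpt]
  exact stdForm_fderiv_cotangentLift _ (hτ.of_le ENat.LEInfty.out) hB hBτ u v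

end

/-! ### Immersions and embeddings -/

section Immersion

variable {E E' H H' P N : Type*} [NormedAddCommGroup E] [NormedSpace ℝ E] [NormedAddCommGroup E']
  [NormedSpace ℝ E'] [TopologicalSpace H] [TopologicalSpace H'] {I : ModelWithCorners ℝ E H}
  {I' : ModelWithCorners ℝ E' H'} [TopologicalSpace P] [ChartedSpace H P] [TopologicalSpace N]
  [ChartedSpace H' N]

-- In the charts of the immersion `f` is a linear inclusion, so projecting back gives a local smooth
-- left inverse `ρ`; apply the chain rule to `ρ ∘ f = id`.
open Manifold in
theorem Manifold.IsImmersionAt.injective_mfderiv [I.Boundaryless] [IsManifold I ∞ P]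
    [IsManifold I' ∞ N] {f : P → N} {q : P} (hf : IsImmersionAt I I' ∞ f q) :
    Function.Injective (mfderiv I I' f q) := by
  set φ := hf.domChart with hφ
  set ψ := hf.codChart with hψ
  have hq : q ∈ φ.source := hf.mem_domChart_source
  have hfq : f q ∈ ψ.source := hf.mem_codChart_source
  let l : E' →L[ℝ] E := .fst ℝ E hf.complement ∘L hf.equiv.symm.toContinuousLinearMap
  have hl : ∀ q' ∈ φ.source, l (ψ.extend I' (f q')) = φ.extend I q' := by
    intro q' hq'
    have h := hf.writtenInCharts ((φ.extend I).map_source (by rwa [φ.extend_source]))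
    simp only [Function.comp_apply, ← hφ, ← hψ] at h
    rw [φ.extend_left_inv hq'] at h
    rw [h]
    simp [l]
  let ρ : N → P := fun y => (φ.extend I).symm (l (ψ.extend I' y))
  have hρf : ρ ∘ f =ᶠ[𝓝 q] id := by
    filter_upwards [φ.open_source.mem_nhds hq] with q' hq'
    simp only [ρ, Function.comp_apply, hl q' hq', id]
    exact φ.extend_left_inv hq'
  have hρ : MDifferentiableAt I' I ρ (f q) := by
    have h1 : ContMDiffAt I' 𝓘(ℝ, E') ∞ (ψ.extend I') (f q) :=
      ψ.contMDiffAt_extend hf.codChart_mem_maximalAtlas hfq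
    have h2 : ContMDiffAt 𝓘(ℝ, E') 𝓘(ℝ, E) ∞ l (ψ.extend I' (f q)) := l.contMDiff.contMDiffAt
    have h3 : ContMDiffAt 𝓘(ℝ, E) I ∞ (φ.extend I).symm (l (ψ.extend I' (f q))) := by
      rw [hl q hq]
      refine (contMDiffOn_extend_symm hf.domChart_mem_maximalAtlas).contMDiffAt ?_
      refine (I.toHomeomorph.isOpenMap _ φ.open_target).mem_nhds ?_
      exact ⟨φ q, φ.map_source hq, rfl⟩
    exact (h3.comp (f q) (h2.comp (f q) h1)).mdifferentiableAt (by simp)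
  have hd : MDifferentiableAt I I' f q := hf.contMDiffAt.mdifferentiableAt (by simp)
  have h := mfderiv_comp q hρ hd
  rw [hρf.mfderiv_eq, mfderiv_id] at h
  intro u v huv
  have := DFunLike.congr_fun h
  rw [show u = _ from this u, show v = _ from this v]
  exact congrArg (mfderiv I' I ρ (f q)) huv

open Manifold in
/-- Immersions can be composed with local diffeomorphisms of the target. -/
theorem Manifold.IsImmersionAtOfComplement.comp_openPartialHomeomorph [IsManifold I ∞ P]
    [IsManifold I' ∞ N] {F : Type*} [NormedAddCommGroup F] [NormedSpace ℝ F] {f g : P → N} {q : P}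
    (hf : IsImmersionAtOfComplement F I I' ∞ f q) (hc : Continuous f)
    (e : OpenPartialHomeomorph N N) (he : ContMDiffOn I' I' ∞ e e.source)
    (he' : ContMDiffOn I' I' ∞ e.symm e.target) (hq : f q ∈ e.source)
    (hg : g =ᶠ[𝓝 q] e ∘ f) : IsImmersionAtOfComplement F I I' ∞ g q := by
  refine IsImmersionAtOfComplement.congr_of_eventuallyEq ?_ hg.symm
  have ho : IsOpen (f ⁻¹' e.source) := e.open_source.preimage hc
  -- Precomposing the target chart with `e.symm` undoes `e`, so the coordinate expression of the
  -- immersion is unchanged.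
  refine .mk_of_continuousAt (f := e ∘ f) ?_ hf.equiv (hf.domChart.restr (f ⁻¹' e.source))
    (e.symm ≫ₕ hf.codChart) ?_ ?_ ?_ ?_ ?_
  · exact (e.continuousAt hq).comp hc.continuousAt
  · rw [OpenPartialHomeomorph.restr_source' _ _ ho]
    exact ⟨hf.mem_domChart_source, hq⟩
  · simp [hq, hf.mem_codChart_source, e.map_source]
  · exact restr_mem_maximalAtlas (contDiffGroupoid ∞ I) hf.domChart_mem_maximalAtlas ho
  · refine OpenPartialHomeomorph.mem_maximalAtlas_of_contMDiffOn _ ?_ ?_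
    · refine (contMDiffOn_of_mem_maximalAtlas hf.codChart_mem_maximalAtlas).comp
        (he'.mono fun x hx => hx.1) fun x hx => hx.2
    · refine he.comp ((contMDiffOn_symm_of_mem_maximalAtlas
        hf.codChart_mem_maximalAtlas).mono fun x hx => hx.1) fun x hx => hx.2
  · intro y hy
    have hy1 : y ∈ (hf.domChart.extend I).target := by
      simp only [OpenPartialHomeomorph.extend_target] at hy ⊢
      exact ⟨hy.1.1, hy.2⟩
    have hy2 : f ((hf.domChart.extend I).symm y) ∈ e.source := by
      have h := ((hf.domChart.restr (f ⁻¹' e.source)).extend I).map_target hy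
      rw [OpenPartialHomeomorph.extend_source, OpenPartialHomeomorph.restr_source' _ _ ho] at h
      exact h.2
    have h := hf.writtenInCharts hy1
    rw [← h]
    simp only [Function.comp_apply, OpenPartialHomeomorph.extend_coe,
      OpenPartialHomeomorph.coe_trans]
    congr 2
    exact e.left_inv hy2

/-- Modifying an embedding by a homeomorphism near a compact set yields an embedding. -/
theorem Topology.IsEmbedding.of_eqOn_compl_of_eqOn [T2Space N] {f g : P → N}
    (hf : IsEmbedding f) (hg : Continuous g) {O C : Set P} {W : Set N} (hC : IsCompact C)
    (hW : IsOpen W) (hWO : f ⁻¹' W = O) (e : OpenPartialHomeomorph N N)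
    (heO : ∀ q ∈ O, f q ∈ e.source) (hgO : ∀ q ∈ O, g q = e (f q))
    (hgC : ∀ q, q ∉ C → g q = f q) (hgW : ∀ q ∈ C, g q ∈ W) (hCO : C ⊆ O) : IsEmbedding g := by
  -- `W` detects from the value `g q` whether `q` lies in `O`. Hence the modified piece cannot meet
  -- or accumulate on the rest, and the two pieces can be treated separately.
  have hgWO : ∀ q, g q ∈ W ↔ q ∈ O := by
    intro q
    by_cases hq : q ∈ C
    · exact ⟨fun _ => hCO hq, fun _ => hgW q hq⟩
    · rw [hgC q hq, ← hWO, mem_preimage]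
  have hinjO : ∀ q ∈ O, ∀ q' ∈ O, g q = g q' → q = q' := by
    intro q hq q' hq' h
    rw [hgO q hq, hgO q' hq'] at h
    exact hf.injective (e.injOn (heO q hq) (heO q' hq') h)
  have hinj : Function.Injective g := by
    intro q q' h
    by_cases hq : q ∈ O
    · exact hinjO q hq q' ((hgWO q').1 (h ▸ (hgWO q).2 hq)) h
    · have hq' : q' ∉ O := fun hq' => hq ((hgWO q).1 (h ▸ (hgWO q').2 hq'))
      rw [hgC q fun h => hq (hCO h), hgC q' fun h => hq' (hCO h)] at h
      exact hf.injective h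
  refine ⟨isInducing_iff_nhds.2 fun q => le_antisymm ?_ ?_, hinj⟩
  · exact hg.continuousAt.tendsto.le_comap
  intro V hV
  obtain ⟨A, hA, hAV⟩ := mem_comap.1 ((hf.nhds_eq_comap q) ▸ hV)
  rw [mem_comap]
  by_cases hq : q ∈ O
  · refine ⟨W ∩ e '' (e.source ∩ A), ?_, ?_⟩
    · refine inter_mem (hW.mem_nhds ((hgWO q).2 hq)) ?_
      rw [hgO q hq]
      exact e.image_mem_nhds (heO q hq) (inter_mem (e.open_source.mem_nhds (heO q hq)) hA)
    · rintro q' ⟨h1, a, ha, h2⟩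
      have hq' := (hgWO q').1 h1
      rw [hgO q' hq'] at h2
      rw [e.injOn ha.1 (heO q' hq') h2] at ha
      exact hAV ha.2
  · have hqC : q ∉ C := fun h => hq (hCO h)
    -- Removing the closed set `g '' C` leaves only points where `g = f`.
    refine ⟨A ∩ (g '' C)ᶜ, inter_mem (by rwa [hgC q hqC]) ?_, ?_⟩
    · refine (hC.image hg).isClosed.isOpen_compl.mem_nhds ?_
      rintro ⟨q', hq', h⟩
      exact hqC (hinj h ▸ hq')
    · rintro q' ⟨h1, h2⟩
      have hq' : q' ∉ C := fun h => h2 ⟨q', h, rfl⟩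
      rw [hgC q' hq'] at h1
      exact hAV h1

end Immersion

/-! ### Small members of smooth families in the Whitney topology -/

/-- The members of a smooth compactly supported family of maps lie in a given basic neighbourhood
for small values of the parameter. -/
theorem WhitneyNhd.eventually_contains {E E' H H' P N X : Type*} [NormedAddCommGroup E]
    [NormedSpace ℝ E] [NormedAddCommGroup E'] [NormedSpace ℝ E'] [NormedAddCommGroup X]
    [NormedSpace ℝ X] [TopologicalSpace H] [TopologicalSpace H'] {I : ModelWithCorners ℝ E H}
    {I' : ModelWithCorners ℝ E' H'} [TopologicalSpace P] [ChartedSpace H P] [TopologicalSpace N]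
    [ChartedSpace H' N] [I.Boundaryless] [IsManifold I ∞ P] [IsManifold I' ∞ N] {f : P → N}
    (𝒰 : WhitneyNhd I I' f) {G : X → P → N} (hG₀ : G 0 = f) {C : Set P} (hC : IsCompact C)
    (hC' : IsClosed C) (hGC : ∀ c, ∀ q ∉ C, G c q = f q)
    (hG : ∀ q, ContMDiffAt (𝓘(ℝ, X).prod I) I' ∞ (Function.uncurry G) (0, q)) :
    ∀ᶠ c in 𝓝 (0 : X), ContMDiff I I' ∞ (G c) → 𝒰.Contains (G c) := by
  -- Only the finitely many `K a` that meet `C` impose a condition on `c`; over the others `G c`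
  -- coincides with `f`.
  have hfin : {a | (𝒰.K a ∩ C).Nonempty}.Finite := 𝒰.locallyFinite.finite_nonempty_inter_compact hC
  let Good : ℕ → X → P → Prop := fun a c q => G c q ∈ (𝒰.chartN a).source ∧
    ∀ m ≤ 𝒰.k, ‖iteratedFDeriv ℝ m (𝒰.inCharts a (G c)) ((𝒰.chartP a).extend I q) -
      iteratedFDeriv ℝ m (𝒰.inCharts a f) ((𝒰.chartP a).extend I q)‖ < 𝒰.ε a
  have hgood : ∀ a, ∀ q ∈ 𝒰.K a, ∀ᶠ r : X × P in 𝓝 (0, q), Good a r.1 r.2 := by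
    intro a q hq
    have hqP := 𝒰.subset_source a hq
    have hqN := 𝒰.mapsTo a hq
    set φ := 𝒰.chartP a with hφ
    set ψ := 𝒰.chartN a with hψ
    set y := φ.extend I q with hy
    have h0q : Function.uncurry G (0, q) = f q := by rw [← hG₀]; rfl
    refine Filter.Eventually.and ?_ ?_
    · refine (hG q).continuousAt (ψ.open_source.mem_nhds ?_)
      rwa [h0q]
    · have hsymm : ContMDiffAt 𝓘(ℝ, E) I ∞ (φ.extend I).symm y := by
        refine (contMDiffOn_extend_symm (𝒰.chartP_mem a)).contMDiffAt ?_
        exact (I.toHomeomorph.isOpenMap _ φ.open_target).mem_nhds ⟨φ q, φ.map_source hqP, rfl⟩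
      have hyq : (φ.extend I).symm y = q := φ.extend_left_inv hqP
      have h1 : ContMDiffAt 𝓘(ℝ, X × E) (𝓘(ℝ, X).prod I) ∞
          (fun r : X × E => (r.1, (φ.extend I).symm r.2)) (0, y) := by
        refine ContMDiffAt.prodMk contDiffAt_fst.contMDiffAt ?_
        exact hsymm.comp (0, y) contDiffAt_snd.contMDiffAt
      have h2 : ContMDiffAt 𝓘(ℝ, X × E) I' ∞
          (fun r : X × E => G r.1 ((φ.extend I).symm r.2)) (0, y) := by
        refine ContMDiffAt.comp (0, y) (g := Function.uncurry G) ?_ h1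
        rw [hyq]
        exact hG q
      have h3 : ContDiffAt ℝ ∞
          (Function.uncurry fun (c : X) => 𝒰.inCharts a (G c)) (0, y) := by
        rw [← contMDiffAt_iff_contDiffAt]
        refine ContMDiffAt.comp (0, y) (g := ψ.extend I') ?_ h2
        refine ψ.contMDiffAt_extend (𝒰.chartN_mem a) ?_
        change G 0 ((φ.extend I).symm y) ∈ ψ.source
        rw [hyq, hG₀]
        exact hqN
      have h4 : ∀ m, ContinuousAt (fun r : X × P =>
          ‖iteratedFDeriv ℝ m (𝒰.inCharts a (G r.1)) (φ.extend I r.2) -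
            iteratedFDeriv ℝ m (𝒰.inCharts a f) (φ.extend I r.2)‖) (0, q) := by
        intro m
        have h5 := (h3.iteratedFDeriv_uncurry m).continuousAt
        have h6 : ContinuousAt (fun r : X × P => (r.1, φ.extend I r.2)) (0, q) :=
          continuousAt_fst.prodMk
            (ContinuousAt.comp (f := Prod.snd) (φ.continuousAt_extend hqP) continuousAt_snd)
        have h7 : ContinuousAt (fun r : X × P => ((0 : X), φ.extend I r.2)) (0, q) :=
          continuousAt_const.prodMk
            (ContinuousAt.comp (f := Prod.snd) (φ.continuousAt_extend hqP) continuousAt_snd)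
        have h8 := (ContinuousAt.comp (f := fun r : X × P => (r.1, φ.extend I r.2))
          (x := (0, q)) h5 h6)
        have h9 := (ContinuousAt.comp (f := fun r : X × P => ((0 : X), φ.extend I r.2))
          (x := (0, q)) h5 h7)
        simpa only [Function.comp_def, hG₀] using! (h8.sub h9).norm
      have h5 : ∀ m ∈ Set.Iic 𝒰.k, ∀ᶠ r : X × P in 𝓝 (0, q),
          ‖iteratedFDeriv ℝ m (𝒰.inCharts a (G r.1)) (φ.extend I r.2) -
            iteratedFDeriv ℝ m (𝒰.inCharts a f) (φ.extend I r.2)‖ < 𝒰.ε a := by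
        intro m _
        refine (h4 m).eventually_lt continuousAt_const ?_
        simp only [hG₀, sub_self, norm_zero]
        exact 𝒰.ε_pos a
      exact (eventually_all_finite (Set.finite_Iic 𝒰.k)).2 h5
  have hev : ∀ᶠ c in 𝓝 (0 : X), ∀ a ∈ {a | (𝒰.K a ∩ C).Nonempty}, ∀ q ∈ 𝒰.K a, Good a c q := by
    refine (eventually_all_finite hfin).2 fun a _ => ?_
    -- Compactness of `K a` turns the estimates near each `(0, q)` into one neighbourhood of `c =
    -- 0`.
    exact (𝒰.isCompact a).eventually_forall_of_forall_eventually (hgood a)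
  filter_upwards [hev] with c hc hsm
  refine ⟨hsm, fun a => ?_⟩
  by_cases ha : (𝒰.K a ∩ C).Nonempty
  · refine ⟨fun q hq => (hc a ha q hq).1, ?_⟩
    rintro m hm _ ⟨q, hq, rfl⟩
    exact (hc a ha q hq).2 m hm
  · have hnot : ∀ q ∈ 𝒰.K a, q ∉ C := fun q hq hqC => ha ⟨q, hq, hqC⟩
    refine ⟨fun q hq => ?_, ?_⟩
    · rw [hGC c q (hnot q hq)]
      exact 𝒰.mapsTo a hq
    rintro m hm _ ⟨q, hq, rfl⟩
    have hqP := 𝒰.subset_source a hq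
    -- Equality of derivatives needs equality near the point, which holds because `C` is closed.
    have heq : 𝒰.inCharts a (G c) =ᶠ[𝓝 ((𝒰.chartP a).extend I q)] 𝒰.inCharts a f := by
      have h1 : ContinuousAt ((𝒰.chartP a).extend I).symm ((𝒰.chartP a).extend I q) :=
        (𝒰.chartP a).continuousAt_extend_symm hqP
      have h2 := h1 (hC'.isOpen_compl.mem_nhds (by
        rw [(𝒰.chartP a).extend_left_inv hqP]
        exact hnot q hq))
      filter_upwards [h2] with y hy
      simp only [WhitneyNhd.inCharts, Function.comp_apply]
      rw [hGC c _ hy]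
    rw [(heq.iteratedFDeriv ℝ m).eq_of_nhds, sub_self, norm_zero]
    exact 𝒰.ε_pos a

/-! ### Local perturbations of Lagrangian submanifolds -/

section Perturbation

variable {n : ℕ} {M : Type*} [TopologicalSpace M] [ChartedSpace (RSpace n) M]
  [IsManifold (𝓡 n) ∞ M]

/-- Points over different base points are separated in `M`; points of one fibre share a canonical
chart and are separated there. -/
theorem t2Space_cotangentBundle [T2Space M] : T2Space (CotangentBundle n M) := by
  have hproj : Continuous (Bundle.TotalSpace.proj : CotangentBundle n M → M) :=
    FiberBundle.continuous_proj (RDual n) _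
  refine ⟨fun z w hzw => ?_⟩
  by_cases h : z.proj = w.proj
  · set e := extChartAt (cotangentModel n) z
    have hz : z ∈ e.source := mem_extChartAt_source z
    have hw : w ∈ e.source := by
      rw [mem_cotangent_chart_source, ← h]
      exact mem_extChartAt_source _
    obtain ⟨u, v, hu, hv, hzu, hwv, huv⟩ := t2_separation fun h => hzw (e.injOn hz hw h)
    have hc : ContinuousOn e e.source := continuousOn_extChartAt z
    have ho : IsOpen e.source := isOpen_extChartAt_source z
    exact ⟨e.source ∩ e ⁻¹' u, e.source ∩ e ⁻¹' v, hc.isOpen_inter_preimage ho hu,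
      hc.isOpen_inter_preimage ho hv, ⟨hz, hzu⟩, ⟨hw, hwv⟩,
      (huv.preimage e).mono inter_subset_right inter_subset_right⟩
  · exact separated_by_continuous hproj h

/-- The canonical chart of the cotangent bundle at `w`, with values in `ℝⁿ × (ℝⁿ)^*`. -/
def cotangentChart (w : CotangentBundle n M) :
    OpenPartialHomeomorph (CotangentBundle n M) (RSpace n × RDual n) where
  toPartialEquiv := extChartAt (cotangentModel n) w
  open_source := isOpen_extChartAt_source w
  open_target := isOpen_extChartAt_target w
  continuousOn_toFun := continuousOn_extChartAt w
  continuousOn_invFun := continuousOn_extChartAt_symm w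

theorem mem_cotangentChart_source (w : CotangentBundle n M) : w ∈ (cotangentChart w).source :=
  mem_extChartAt_source w

theorem contMDiffOn_cotangentChart (w : CotangentBundle n M) :
    ContMDiffOn (cotangentModel n) 𝓘(ℝ, RSpace n × RDual n) ∞ (cotangentChart w)
      (cotangentChart w).source := by
  change ContMDiffOn _ _ _ (extChartAt (cotangentModel n) w)
    (extChartAt (cotangentModel n) w).source
  rw [extChartAt_source]
  exact contMDiffOn_extChartAt

theorem contMDiffOn_cotangentChart_symm (w : CotangentBundle n M) :
    ContMDiffOn 𝓘(ℝ, RSpace n × RDual n) (cotangentModel n) ∞ (cotangentChart w).symm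
      (cotangentChart w).target :=
  contMDiffOn_extChartAt_symm w

theorem contMDiffAt_cotangentChart {w z : CotangentBundle n M}
    (hz : z ∈ (cotangentChart w).source) :
    ContMDiffAt (cotangentModel n) 𝓘(ℝ, RSpace n × RDual n) ∞ (cotangentChart w) z :=
  (contMDiffOn_cotangentChart w).contMDiffAt ((cotangentChart w).open_source.mem_nhds hz)

theorem contMDiffAt_cotangentChart_symm {w : CotangentBundle n M} {y : RSpace n × RDual n}
    (hy : y ∈ (cotangentChart w).target) :
    ContMDiffAt 𝓘(ℝ, RSpace n × RDual n) (cotangentModel n) ∞ (cotangentChart w).symm y :=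
  (contMDiffOn_cotangentChart_symm w).contMDiffAt ((cotangentChart w).open_target.mem_nhds hy)

theorem stdForm_mfderiv_cotangentChart {z w : CotangentBundle n M}
    (hz : z ∈ (cotangentChart w).source) (u v : TangentSpace (cotangentModel n) z) :
    stdForm (mfderiv (cotangentModel n) 𝓘(ℝ, RSpace n × RDual n) (cotangentChart w) z u)
      (mfderiv (cotangentModel n) 𝓘(ℝ, RSpace n × RDual n) (cotangentChart w) z v) =
      symplecticForm z u v :=
  stdForm_mfderiv_extChartAt hz u v

variable {P : Type*}

open Classical in
/-- The map `f` followed over `O` by the map that is `Φ` in the chart `ψ`. -/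
def perturbOn (ψ : OpenPartialHomeomorph (CotangentBundle n M) (RSpace n × RDual n))
    (Φ : RSpace n × RDual n → RSpace n × RDual n) (f : P → CotangentBundle n M) (O : Set P)
    (q : P) : CotangentBundle n M :=
  if q ∈ O then ψ.symm (Φ (ψ (f q))) else f q

theorem perturbOn_of_mem {ψ : OpenPartialHomeomorph (CotangentBundle n M) (RSpace n × RDual n)}
    {Φ : RSpace n × RDual n → RSpace n × RDual n} {f : P → CotangentBundle n M} {O : Set P}
    {q : P} (hq : q ∈ O) : perturbOn ψ Φ f O q = ψ.symm (Φ (ψ (f q))) := if_pos hq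

theorem perturbOn_of_fixed {ψ : OpenPartialHomeomorph (CotangentBundle n M) (RSpace n × RDual n)}
    {Φ : RSpace n × RDual n → RSpace n × RDual n} {f : P → CotangentBundle n M} {O : Set P}
    {q : P} (hq : q ∈ O → f q ∈ ψ.source ∧ Φ (ψ (f q)) = ψ (f q)) :
    perturbOn ψ Φ f O q = f q := by
  unfold perturbOn
  split_ifs with h
  · rw [(hq h).2, ψ.left_inv (hq h).1]
  · rfl

variable [TopologicalSpace P] [ChartedSpace (RSpace n) P]

/-- The pull-back of the symplectic form in canonical coordinates. -/
theorem stdForm_mfderiv_cotangentChart_comp {w : CotangentBundle n M}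
    {f : P → CotangentBundle n M} {q : P}
    (hf : MDifferentiableAt (𝓡 n) (cotangentModel n) f q)
    (hq : f q ∈ (cotangentChart w).source) (u v : TangentSpace (𝓡 n) q) :
    stdForm (mfderiv (𝓡 n) 𝓘(ℝ, RSpace n × RDual n) (cotangentChart w ∘ f) q u)
      (mfderiv (𝓡 n) 𝓘(ℝ, RSpace n × RDual n) (cotangentChart w ∘ f) q v) =
    symplecticForm (f q) (mfderiv (𝓡 n) (cotangentModel n) f q u)
      (mfderiv (𝓡 n) (cotangentModel n) f q v) := by
  rw [← stdForm_mfderiv_cotangentChart hq,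
    mfderiv_comp q ((contMDiffAt_cotangentChart hq).mdifferentiableAt (by simp)) hf]
  rfl

variable [IsManifold (𝓡 n) ∞ P]

/-- A local perturbation of a Lagrangian embedding by a tilted shear that does not leave the
neighbourhood `W` is a Lagrangian embedding. -/
theorem IsLagrangianEmbedding.perturbOn_tiltedShear [T2Space M] {i : P → CotangentBundle n M}
    (hi : IsLagrangianEmbedding i) (w : CotangentBundle n M) {O C : Set P}
    {W : Set (CotangentBundle n M)} (hW : IsOpen W) (hWO : i ⁻¹' W = O) (hC : IsCompact C)
    (hCO : C ⊆ O) (hOw : ∀ q ∈ O, i q ∈ (cotangentChart w).source) (s : ℝ)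
    {σ : RSpace n → RDual n} (hσ : ContDiff ℝ ∞ σ)
    (hsymm : ∀ x a b, fderiv ℝ σ x a b = fderiv ℝ σ x b a)
    (hfix : ∀ q ∈ O, q ∉ C →
      tiltedShear s σ (cotangentChart w (i q)) = cotangentChart w (i q))
    (htarget : ∀ q ∈ C, tiltedShear s σ (cotangentChart w (i q)) ∈ (cotangentChart w).target)
    (hCW : ∀ q ∈ C, (cotangentChart w).symm (tiltedShear s σ (cotangentChart w (i q))) ∈ W) :
    IsLagrangianEmbedding (perturbOn (cotangentChart w) (tiltedShear s σ) i O) := by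
  have := t2Space_cotangentBundle (n := n) (M := M)
  set ψ := cotangentChart w
  set Φ := tiltedShear s σ
  set j := perturbOn ψ Φ i O
  have hemb := hi.isSmoothEmbedding.isEmbedding
  have : T2Space P := hemb.t2Space
  have hO : IsOpen O := hWO ▸ hW.preimage hemb.continuous
  have hsmooth : ContMDiff (𝓡 n) (cotangentModel n) ∞ i := hi.isSmoothEmbedding.contMDiff
  have hjO : ∀ q ∈ O, j q = ψ.symm (Φ (ψ (i q))) := fun q hq => perturbOn_of_mem hq
  have hjC : ∀ q, q ∉ C → j q = i q := fun q hq =>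
    perturbOn_of_fixed fun h => ⟨hOw q h, hfix q h hq⟩
  have htarget' : ∀ q ∈ O, Φ (ψ (i q)) ∈ ψ.target := by
    intro q hq
    by_cases hqC : q ∈ C
    · exact htarget q hqC
    · rw [hfix q hq hqC]
      exact ψ.map_source (hOw q hq)
  have hΦ : ContDiff ℝ ∞ Φ := hσ.tiltedShear s
  have hΦ' : ContDiff ℝ ∞ (tiltedShear s (-σ)) := hσ.neg.tiltedShear s
  let T : OpenPartialHomeomorph _ _ := (tiltedShearHomeomorph s σ hσ).toOpenPartialHomeomorph
  -- The shear conjugated by the chart, defined where its values stay in the chart's target.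
  let e : OpenPartialHomeomorph (CotangentBundle n M) (CotangentBundle n M) :=
    (ψ ≫ₕ T) ≫ₕ ψ.symm
  have hes : ∀ z, z ∈ e.source ↔ z ∈ ψ.source ∧ Φ (ψ z) ∈ ψ.target := by
    intro z
    simp [e, T, tiltedShearHomeomorph, Φ]
  have het : ∀ z, z ∈ e.target ↔ z ∈ ψ.source ∧ tiltedShear s (-σ) (ψ z) ∈ ψ.target := by
    intro z
    simp [e, T, tiltedShearHomeomorph]
  have hesm : ContMDiffOn (cotangentModel n) (cotangentModel n) ∞ e e.source := by
    intro z hz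
    have hz := (hes z).1 hz
    refine ContMDiffAt.contMDiffWithinAt ?_
    exact ContMDiffAt.comp z (g := ψ.symm) (f := Φ ∘ ψ) (contMDiffAt_cotangentChart_symm hz.2)
      (hΦ.contMDiff.contMDiffAt.comp z (contMDiffAt_cotangentChart hz.1))
  have hesm' : ContMDiffOn (cotangentModel n) (cotangentModel n) ∞ e.symm e.target := by
    intro z hz
    have hz := (het z).1 hz
    refine ContMDiffAt.contMDiffWithinAt ?_
    exact ContMDiffAt.comp z (g := ψ.symm) (f := tiltedShear s (-σ) ∘ ψ)
      (contMDiffAt_cotangentChart_symm hz.2)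
      (hΦ'.contMDiff.contMDiffAt.comp z (contMDiffAt_cotangentChart hz.1))
  have hOe : ∀ q ∈ O, i q ∈ e.source := fun q hq => (hes _).2 ⟨hOw q hq, htarget' q hq⟩
  have hjO' : ∀ q ∈ O, j =ᶠ[𝓝 q] e ∘ i := fun q hq => by
    filter_upwards [hO.mem_nhds hq] with q' hq'
    exact hjO q' hq'
  have hjC' : ∀ q, q ∉ O → j =ᶠ[𝓝 q] i := fun q hq => by
    filter_upwards [hC.isClosed.isOpen_compl.mem_nhds fun h => hq (hCO h)] with q' hq'
    exact hjC q' hq'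
  have himm : Manifold.IsImmersion (𝓡 n) (cotangentModel n) ∞ j := by
    obtain ⟨F, _, _, hF⟩ := hi.isSmoothEmbedding.isImmersion
    refine ⟨F, inferInstance, inferInstance, fun q => ?_⟩
    by_cases hq : q ∈ O
    · exact (hF q).comp_openPartialHomeomorph hsmooth.continuous e hesm hesm' (hOe q hq)
        (hjO' q hq)
    · exact (hF q).congr_of_eventuallyEq (hjC' q hq).symm
  refine ⟨⟨himm, ?_⟩, ?_⟩
  · refine hemb.of_eqOn_compl_of_eqOn himm.contMDiff.continuous hC hW hWO e hOe
      (fun q hq => (hjO' q hq).eq_of_nhds) hjC (fun q hq => ?_) hCO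
    rw [hjO q (hCO hq)]
    exact hCW q hq
  · intro q u v
    by_cases hq : q ∈ O
    · have hjq : j q ∈ ψ.source := by
        rw [hjO q hq]
        exact ψ.map_target (htarget' q hq)
      have heq : ψ ∘ j =ᶠ[𝓝 q] Φ ∘ (ψ ∘ i) := by
        filter_upwards [hO.mem_nhds hq] with q' hq'
        simp only [Function.comp_apply]
        rw [hjO q' hq', ψ.right_inv (htarget' q' hq')]
      have hd : MDifferentiableAt (𝓡 n) 𝓘(ℝ, RSpace n × RDual n) (ψ ∘ i) q :=
        ((contMDiffAt_cotangentChart (hOw q hq)).comp q hsmooth.contMDiffAt).mdifferentiableAt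
          (by simp)
      have hdΦ : MDifferentiableAt 𝓘(ℝ, RSpace n × RDual n) 𝓘(ℝ, RSpace n × RDual n) Φ
          ((ψ ∘ i) q) := (hΦ.differentiable (by simp) _).mdifferentiableAt
      rw [← stdForm_mfderiv_cotangentChart_comp
        (himm.contMDiff.contMDiffAt.mdifferentiableAt (by simp)) hjq, heq.mfderiv_eq,
        mfderiv_comp q hdΦ hd, mfderiv_eq_fderiv]
      refine (stdForm_fderiv_tiltedShear s _ (hσ.differentiable (by simp) _) (hsymm _)
        _ _).trans ?_
      exact (stdForm_mfderiv_cotangentChart_comp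
        (hsmooth.contMDiffAt.mdifferentiableAt (by simp)) (hOw q hq) u v).trans
        (hi.isotropic q u v)
    · have heq := hjC' q hq
      rw [heq.mfderiv_eq]
      -- Off `O` the points `j q` and `i q` agree only propositionally. The formula for the form in
      -- model coordinates does not involve the base point, which permits the exchange.
      have : ∀ z z' : CotangentBundle n M, ∀ a b : RSpace n × RDual n,
        symplecticForm z a b = symplecticForm z' a b := fun _ _ _ _ => rfl
      exact (this _ _ _ _).trans (hi.isotropic q u v)

/-- A map to `ℝⁿ` with injective differential is a local homeomorphism. -/
theorem exists_openPartialHomeomorph_of_injective_mfderiv {g : P → RSpace n} {q : P}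
    (hg : ContMDiffAt (𝓡 n) 𝓘(ℝ, RSpace n) ∞ g q)
    (hinj : Function.Injective (mfderiv (𝓡 n) 𝓘(ℝ, RSpace n) g q)) :
    ∃ e : OpenPartialHomeomorph P (RSpace n), q ∈ e.source ∧ ∀ q' ∈ e.source, e q' = g q' := by
  let φ : OpenPartialHomeomorph P (RSpace n) := chartAt (RSpace n) q
  have hq : q ∈ φ.source := mem_chart_source _ q
  have hG : ContDiffAt ℝ ∞ (g ∘ φ.symm) (φ q) := by
    rw [← contMDiffAt_iff_contDiffAt]
    have h1 : ContMDiffAt (𝓡 n) (𝓡 n) ∞ φ.symm (φ q) :=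
      contMDiffAt_symm_of_mem_maximalAtlas (IsManifold.chart_mem_maximalAtlas q)
        (φ.map_source hq)
    refine ContMDiffAt.comp (φ q) (g := g) ?_ h1
    rw [φ.left_inv hq]
    exact hg
  have hD : mfderiv (𝓡 n) 𝓘(ℝ, RSpace n) g q = fderiv ℝ (g ∘ φ.symm) (φ q) := by
    rw [(hg.mdifferentiableAt (by simp)).mfderiv, ModelWithCorners.range_eq_univ,
      fderivWithin_univ]
    rfl
  rw [hD] at hinj
  let D : RSpace n ≃L[ℝ] RSpace n :=
    (LinearEquiv.ofInjectiveEndo (fderiv ℝ (g ∘ φ.symm) (φ q)).toLinearMap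
      hinj).toContinuousLinearEquiv
  have hstrict : HasStrictFDerivAt (g ∘ φ.symm) (D : RSpace n →L[ℝ] RSpace n) (φ q) :=
    hG.hasStrictFDerivAt (by simp)
  let e₀ := hstrict.toOpenPartialHomeomorph
  refine ⟨φ ≫ₕ e₀, ?_, ?_⟩
  · rw [OpenPartialHomeomorph.trans_source]
    exact ⟨hq, hstrict.mem_toOpenPartialHomeomorph_source⟩
  · intro q' hq'
    rw [OpenPartialHomeomorph.trans_source] at hq'
    change (g ∘ φ.symm) (φ q') = g q'
    rw [Function.comp_apply, φ.left_inv hq'.1]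

/-- Near each of its points a Lagrangian submanifold is a graph over a tilted coordinate plane. -/
theorem IsLagrangianEmbedding.exists_tilted_chart {i : P → CotangentBundle n M}
    (hi : IsLagrangianEmbedding i) (q : P) :
    ∃ (s : ℝ) (e : OpenPartialHomeomorph P (RSpace n)), q ∈ e.source ∧ ∀ q' ∈ e.source,
      i q' ∈ (cotangentChart (i q)).source ∧
      e q' = (cotangentChart (i q) (i q')).1 + s • sharp n (cotangentChart (i q) (i q')).2 := by
  set ψ := cotangentChart (i q)
  have hsmooth : ContMDiff (𝓡 n) (cotangentModel n) ∞ i := hi.isSmoothEmbedding.contMDiff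
  have hqψ : i q ∈ ψ.source := mem_cotangentChart_source _
  have hψ : ContMDiffAt (𝓡 n) 𝓘(ℝ, RSpace n × RDual n) ∞ (ψ ∘ i) q :=
    (contMDiffAt_cotangentChart hqψ).comp q hsmooth.contMDiffAt
  have hd : MDifferentiableAt (𝓡 n) (cotangentModel n) i q :=
    hsmooth.contMDiffAt.mdifferentiableAt (by simp)
  let D : RSpace n →L[ℝ] RSpace n × RDual n :=
    mfderiv (𝓡 n) 𝓘(ℝ, RSpace n × RDual n) (ψ ∘ i) q
  have hDinj : Function.Injective D := by
    have h1 : D = (mfderiv (cotangentModel n) 𝓘(ℝ, RSpace n × RDual n) ψ (i q)).comp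
        (mfderiv (𝓡 n) (cotangentModel n) i q) :=
      mfderiv_comp q ((contMDiffAt_cotangentChart hqψ).mdifferentiableAt (by simp)) hd
    have h2 : Function.Injective
        (mfderiv (cotangentModel n) 𝓘(ℝ, RSpace n × RDual n) ψ (i q)) :=
      (isInvertible_mfderiv_extChartAt (I := cotangentModel n) hqψ).injective
    rw [h1]
    exact h2.comp (hi.isSmoothEmbedding.isImmersion.isImmersionAt q).injective_mfderiv
  have hDiso : ∀ u v, stdForm (D u) (D v) = 0 := fun u v =>
    (stdForm_mfderiv_cotangentChart_comp hd hqψ u v).trans (hi.isotropic q u v)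
  obtain ⟨s, hs⟩ := exists_injective_tilt D hDinj hDiso
  let l : RSpace n × RDual n →L[ℝ] RSpace n := .fst ℝ _ _ + s • (sharp n ∘L .snd ℝ _ _)
  have hg : ContMDiffAt (𝓡 n) 𝓘(ℝ, RSpace n) ∞ (l ∘ (ψ ∘ i)) q :=
    -- By the choice of `s` this map, the tilted coordinate restricted to the submanifold, has
    -- injective differential at `q`.
    l.contMDiff.contMDiffAt.comp q hψ
  have hginj : Function.Injective (mfderiv (𝓡 n) 𝓘(ℝ, RSpace n) (l ∘ (ψ ∘ i)) q) := by
    rw [mfderiv_comp q l.mdifferentiableAt (hψ.mdifferentiableAt (by simp)),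
      ContinuousLinearMap.mfderiv_eq]
    exact hs
  obtain ⟨e, hqe, he⟩ := exists_openPartialHomeomorph_of_injective_mfderiv hg hginj
  have ho : IsOpen (i ⁻¹' ψ.source) := ψ.open_source.preimage hsmooth.continuous
  refine ⟨s, e.restr (i ⁻¹' ψ.source), ?_, ?_⟩
  · rw [OpenPartialHomeomorph.restr_source' _ _ ho]
    exact ⟨hqe, hqψ⟩
  · intro q' hq'
    rw [OpenPartialHomeomorph.restr_source' _ _ ho] at hq'
    exact ⟨hq'.2, he q' hq'.1⟩

/-- The perturbations of a Lagrangian embedding by cut-off translations of the tilted fibres are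
close Lagrangian embeddings if the translation vector is small. -/
theorem IsLagrangianEmbedding.eventually_perturbOn [T2Space M]
    {i : P → CotangentBundle n M} (hi : IsLagrangianEmbedding i)
    (𝒰 : WhitneyNhd (𝓡 n) (cotangentModel n) i) (w : CotangentBundle n M) (s : ℝ)
    (e : OpenPartialHomeomorph P (RSpace n))
    (he : ∀ q ∈ e.source, i q ∈ (cotangentChart w).source ∧
      e q = (cotangentChart w (i q)).1 + s • sharp n (cotangentChart w (i q)).2)
    {χ : RSpace n → ℝ} (hχ : ContDiff ℝ ∞ χ) {C : Set P} (hC : IsCompact C) (hCO : C ⊆ e.source)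
    (hχC : ∀ q ∈ e.source, e q ∈ tsupport χ → q ∈ C) :
    ∀ᶠ c in 𝓝 (0 : RDual n),
      IsLagrangianEmbedding
        (perturbOn (cotangentChart w) (tiltedShear s (cutoffForm χ c)) i e.source) ∧
      𝒰.Contains (perturbOn (cotangentChart w) (tiltedShear s (cutoffForm χ c)) i e.source) := by
  have := t2Space_cotangentBundle (n := n) (M := M)
  have hemb := hi.isSmoothEmbedding.isEmbedding
  have : T2Space P := hemb.t2Space
  have hsmooth : ContMDiff (𝓡 n) (cotangentModel n) ∞ i := hi.isSmoothEmbedding.contMDiff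
  set ψ := cotangentChart w
  let Φ : RDual n → RSpace n × RDual n → RSpace n × RDual n := fun c =>
    tiltedShear s (cutoffForm χ c)
  have hΦ : ContDiff ℝ ∞ fun r : RDual n × RSpace n × RDual n => Φ r.1 r.2 := by
    have h := contDiff_cutoffForm hχ
    have h1 : ContDiff ℝ ∞ fun r : RDual n × RSpace n × RDual n =>
        cutoffForm χ r.1 (r.2.1 + s • sharp n r.2.2) :=
      h.comp (g := fun q : RDual n × RSpace n => cutoffForm χ q.1 q.2)
        (f := fun r : RDual n × RSpace n × RDual n => (r.1, r.2.1 + s • sharp n r.2.2))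
        (by fun_prop)
    simp only [Φ, tiltedShear]
    fun_prop
  have hΦ₀ : ∀ y, Φ 0 y = y := fun y => tiltedShear_of_eq_zero (by rw [cutoffForm_zero]; rfl)
  have hfix : ∀ c, ∀ q' ∈ e.source, q' ∉ C → Φ c (ψ (i q')) = ψ (i q') := by
    intro c q' hq' hq'C
    refine tiltedShear_of_eq_zero (cutoffForm_of_notMem_tsupport c ?_)
    rw [← (he q' hq').2]
    exact fun h => hq'C (hχC q' hq' h)
  let J : RDual n → P → CotangentBundle n M := fun c => perturbOn ψ (Φ c) i e.source
  have hJ₀ : J 0 = i := funext fun q' => perturbOn_of_fixed fun h => ⟨(he q' h).1, hΦ₀ _⟩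
  have hJC : ∀ c, ∀ q' ∉ C, J c q' = i q' := fun c q' hq' =>
    perturbOn_of_fixed fun h => ⟨(he q' h).1, hfix c q' h hq'⟩
  have hψi : ∀ q' ∈ e.source, ContMDiffAt (𝓘(ℝ, RDual n).prod (𝓡 n))
      𝓘(ℝ, RSpace n × RDual n) ∞ (fun r : RDual n × P => Φ r.1 (ψ (i r.2))) (0, q') := by
    intro q' hq'
    have h1 : ContMDiffAt (𝓘(ℝ, RDual n).prod (𝓡 n)) 𝓘(ℝ, RSpace n × RDual n) ∞
        (fun r : RDual n × P => ψ (i r.2)) (0, q') :=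
      ContMDiffAt.comp (0, q') (g := ψ) (contMDiffAt_cotangentChart (he q' hq').1)
        (hsmooth.contMDiffAt.comp (0, q') contMDiffAt_snd)
    exact ContMDiffAt.comp (0, q') (I' := 𝓘(ℝ, RDual n × RSpace n × RDual n))
      (g := fun r : RDual n × RSpace n × RDual n => Φ r.1 r.2)
      hΦ.contMDiff.contMDiffAt (contMDiffAt_fst.prodMk_space h1)
  have hJ : ∀ q', ContMDiffAt (𝓘(ℝ, RDual n).prod (𝓡 n)) (cotangentModel n) ∞
      (Function.uncurry J) (0, q') := by
    intro q'
    by_cases hq' : q' ∈ e.source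
    · have h0 : Φ 0 (ψ (i q')) ∈ ψ.target := by
        rw [hΦ₀]
        exact ψ.map_source (he q' hq').1
      have h1 : ContMDiffAt (𝓘(ℝ, RDual n).prod (𝓡 n)) (cotangentModel n) ∞
          (fun r : RDual n × P => ψ.symm (Φ r.1 (ψ (i r.2)))) (0, q') :=
        ContMDiffAt.comp (0, q') (g := ψ.symm) (contMDiffAt_cotangentChart_symm h0) (hψi q' hq')
      refine h1.congr_of_eventuallyEq ?_
      filter_upwards [continuousAt_snd (e.open_source.mem_nhds hq')] with r hr
      exact perturbOn_of_mem (O := e.source) hr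
    · have h1 : ContMDiffAt (𝓘(ℝ, RDual n).prod (𝓡 n)) (cotangentModel n) ∞
          (fun r : RDual n × P => i r.2) (0, q') :=
        hsmooth.contMDiffAt.comp (0, q') contMDiffAt_snd
      refine h1.congr_of_eventuallyEq ?_
      filter_upwards [continuousAt_snd
        (hC.isClosed.isOpen_compl.mem_nhds fun h => hq' (hCO h))] with r hr
      exact hJC r.1 r.2 hr
  -- As `i` is an embedding, an open `W` isolates the sheet over `e.source`. For small `c` the moved
  -- compact part stays inside `W`.
  obtain ⟨W, hW, hWO⟩ := hemb.isOpen_iff.1 e.open_source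
  have hstay : ∀ᶠ c in 𝓝 (0 : RDual n), ∀ q' ∈ C, Φ c (ψ (i q')) ∈ ψ.target ∧ J c q' ∈ W := by
    refine hC.eventually_forall_of_forall_eventually fun q' hq' => ?_
    refine Filter.Eventually.and ?_ ?_
    · refine (hψi q' (hCO hq')).continuousAt (ψ.open_target.mem_nhds ?_)
      simp only [hΦ₀]
      exact ψ.map_source (he q' (hCO hq')).1
    · refine (hJ q').continuousAt (hW.mem_nhds ?_)
      simp only [Function.uncurry, hJ₀]
      exact hWO.ge (hCO hq')
  filter_upwards [hstay, 𝒰.eventually_contains hJ₀ hC hC.isClosed hJC hJ] with c hc hc'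
  have hσ : ContDiff ℝ ∞ (cutoffForm χ c) :=
    (contDiff_cutoffForm hχ).comp (contDiff_const.prodMk contDiff_id)
  have hL : IsLagrangianEmbedding (J c) := by
    refine hi.perturbOn_tiltedShear w hW hWO hC hCO (fun q' hq' => (he q' hq').1) s hσ
      (fderiv_cutoffForm_symm hχ c) (hfix c) (fun q' hq' => (hc q' hq').1) fun q' hq' => ?_
    have h := (hc q' hq').2
    rwa [show J c q' = _ from perturbOn_of_mem (hCO hq')] at h
  exact ⟨hL, hc' hL.isSmoothEmbedding.contMDiff⟩

/-- Each point near a Lagrangian submanifold lies on a Lagrangian submanifold that is close to it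
in the strong topology. -/
theorem IsLagrangianEmbedding.eventually_exists_contains [T2Space M]
    {i : P → CotangentBundle n M} (hi : IsLagrangianEmbedding i)
    (𝒰 : WhitneyNhd (𝓡 n) (cotangentModel n) i) (q : P) :
    ∀ᶠ z in 𝓝 (i q), ∃ j : P → CotangentBundle n M,
      IsLagrangianEmbedding j ∧ 𝒰.Contains j ∧ z ∈ range j := by
  have hsmooth : ContMDiff (𝓡 n) (cotangentModel n) ∞ i := hi.isSmoothEmbedding.contMDiff
  obtain ⟨s, e, hqe, he⟩ := hi.exists_tilted_chart q
  set ψ := cotangentChart (i q)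
  have hqψ : i q ∈ ψ.source := mem_cotangentChart_source _
  obtain ⟨r, hr, hball⟩ := Metric.nhds_basis_closedBall.mem_iff.1
    (e.open_target.mem_nhds (e.map_source hqe))
  -- The bump is `1` on the ball of radius `r / 2`, where `X z` will lie, and its support stays
  -- within `e.target`.
  let χ : ContDiffBump (e q) := ⟨r / 2, r, by positivity, by linarith⟩
  have hχ : ContDiff ℝ ∞ (χ : RSpace n → ℝ) := χ.contDiff
  have hχt : tsupport (χ : RSpace n → ℝ) = Metric.closedBall (e q) r := χ.tsupport_eq
  set C := e.symm '' Metric.closedBall (e q) r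
  have hC : IsCompact C :=
    (isCompact_closedBall _ _).image_of_continuousOn (e.continuousOn_symm.mono hball)
  have hCO : C ⊆ e.source := by
    rintro _ ⟨x, hx, rfl⟩
    exact e.map_target (hball hx)
  have hχC : ∀ q' ∈ e.source, e q' ∈ tsupport χ → q' ∈ C := fun q' hq' h =>
    ⟨e q', hχt ▸ h, e.left_inv hq'⟩
  let J : RDual n → P → CotangentBundle n M := fun c =>
    perturbOn ψ (tiltedShear s (cutoffForm χ c)) i e.source
  have hgood : ∀ᶠ c in 𝓝 (0 : RDual n), IsLagrangianEmbedding (J c) ∧ 𝒰.Contains (J c) :=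
    hi.eventually_perturbOn 𝒰 (i q) s e he hχ hC hCO hχC
  let X : CotangentBundle n M → RSpace n := fun z => (ψ z).1 + s • sharp n (ψ z).2
  -- The point of the submanifold with the same tilted coordinate as `z` is `i (e.symm (X z))`; `c
  -- z` is the difference of the momenta.
  let c : CotangentBundle n M → RDual n := fun z => (ψ z).2 - (ψ (i (e.symm (X z)))).2
  have hψc : ContinuousAt ψ (i q) := ψ.continuousAt hqψ
  have hX : ContinuousAt X (i q) := by
    have h1 : ContinuousAt (fun z => sharp n (ψ z).2) (i q) :=
      (sharp n).continuous.continuousAt.comp hψc.snd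
    exact hψc.fst.add (h1.const_smul s)
  have hXq : X (i q) = e q := ((he q hqe).2).symm
  have hYq : e.symm (X (i q)) = q := by rw [hXq, e.left_inv hqe]
  have hY : ContinuousAt (fun z => e.symm (X z)) (i q) := by
    refine ContinuousAt.comp (g := e.symm) ?_ hX
    rw [hXq]
    exact e.continuousAt_symm (e.map_source hqe)
  have hc : ContinuousAt c (i q) := by
    refine hψc.snd.sub (ContinuousAt.snd ?_)
    refine ContinuousAt.comp (g := ψ) (f := fun z => i (e.symm (X z))) ?_ ?_
    · simp only [hYq]
      exact hψc
    · exact hsmooth.continuous.continuousAt.comp hY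
  have hcq : c (i q) = 0 := by simp only [c, hYq, sub_self]
  have hevc : ∀ᶠ z in 𝓝 (i q), IsLagrangianEmbedding (J (c z)) ∧ 𝒰.Contains (J (c z)) := by
    have h : Tendsto c (𝓝 (i q)) (𝓝 0) := hcq ▸ hc
    exact h.eventually hgood
  have hevX : ∀ᶠ z in 𝓝 (i q), X z ∈ Metric.ball (e q) (r / 2) :=
    hX (by rw [hXq]; exact Metric.ball_mem_nhds _ (by positivity))
  filter_upwards [hevc, hevX, ψ.open_source.mem_nhds hqψ] with z hz hzX hzψ
  refine ⟨J (c z), hz.1, hz.2, e.symm (X z), ?_⟩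
  have hXt : X z ∈ e.target :=
    hball (Metric.closedBall_subset_closedBall (by linarith) (Metric.ball_subset_closedBall hzX))
  have hys := e.map_target hXt
  have hcut : cutoffForm χ (c z) (X z) = c z :=
    cutoffForm_of_eventuallyEq_one _ (χ.eventuallyEq_one_of_mem_ball hzX)
  have htilt : (ψ (i (e.symm (X z)))).1 + s • sharp n (ψ (i (e.symm (X z)))).2 = X z := by
    rw [← (he _ hys).2, e.right_inv hXt]
  -- The momenta agree by the choice of `c z`, and the positions because both equal the common `X z`
  -- minus `s p^♯`.
  have hval : tiltedShear s (cutoffForm χ (c z)) (ψ (i (e.symm (X z)))) = ψ z := by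
    simp only [tiltedShear, htilt, hcut]
    refine Prod.ext ?_ (add_sub_cancel _ _)
    have h1 := eq_sub_of_add_eq htilt
    simp only [c, map_sub, smul_sub]
    rw [h1]
    simp only [X]
    abel
  rw [show J (c z) _ = _ from perturbOn_of_mem hys, hval, ψ.left_inv hzψ]

end Perturbation

end

theorem mainTheorem7 {n : ℕ} {M : Type*} [TopologicalSpace M] [T2Space M]
    [SecondCountableTopology M] [ChartedSpace (RSpace n) M] [IsManifold (𝓡 n) ∞ M]
    (𝓗 : HybridHamiltonianSystem n M) (hspasmodic : 𝓗.FreeOfSpasmodicZeno)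
    (x : M) (hx : 𝓗.AlmostNoSteadyZeno x) (T : ℝ) (hT : 0 ≤ T)
    {P : Type*} [TopologicalSpace P] [ChartedSpace (RSpace n) P] [IsManifold (𝓡 n) ∞ P]
    (i : P → CotangentBundle n M) (hi : IsLagrangianEmbedding i)
    (hmiss : 𝓗.lift.flowImage T (𝓗.nonZenoFiber x) ∩ range i = ∅)
    (hclosure : (closure (𝓗.lift.flowImage T (𝓗.nonZenoFiber x)) ∩ range i).Nonempty)
    (𝒰 : WhitneyNhd (𝓡 n) (cotangentModel n) i) :
    ∃ j : P → CotangentBundle n M, IsLagrangianEmbedding j ∧ 𝒰.Contains j ∧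
      (𝓗.lift.flowImage T (𝓗.nonZenoFiber x) ∩ range j).Nonempty := by
  obtain ⟨_, hw, q, rfl⟩ := hclosure
  obtain ⟨z, hz, j, hj, hj𝒰, hzj⟩ := (mem_closure_iff_frequently.1 hw).and_eventually
    (hi.eventually_exists_contains 𝒰 q) |>.exists
  exact ⟨j, hj, hj𝒰, z, hz, hzj⟩
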